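/- Let $G$ be a Lie group, let $\pi:P\to M$ be a smooth principal $G$-bundle (with right action of $G$ on $P$) over a smooth manifold $M$ (finite-dimensional, without boundary), and let $\hat{\mathcal A}$ be a smooth connection on $P$ (a connection form with values in the Lie algebra of $G$) which is flat, i.e. whose curvature vanishes identically. Fix $p_0\in P$ and put $x_0=\pi(p_0)$. For a piecewise $C^1$ loop $c$ based at $x_0$ let $\hat{\mathcal U}_c\in G$ be its holonomy, i.e. the element such that the horizontal lift $\tilde c$ of $c$ with $\tilde c(0)=p_0$ satisfies $\tilde c(1)=p_0\cdot \hat{\mathcal U}_c$, and let $$\mathrm{Hol}_{p_0}(\hat{\mathcal A})=\{\hat{\mathcal U}_c \mid c \text{ a piecewise } C^1 \text{ loop based at } x_0\}\subseteq G .$$ Then every class in $\pi_1(M,x_0)$ contains a piecewise $C^1$ loop, every piecewise $C^1$ loop based at $x_0$ has exactly one holonomy, and any two homotopic (relative to endpoints) piecewise $C^1$ loops have the same holonomy, so that $[c]\mapsto \hat{\mathcal U}_{[c]}:=\hat{\mathcal U}_c$ is well defined on $\pi_1(M,x_0)$. Moreover $\mathrm{Hol}_{p_0}(\hat{\mathcal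 A})$ is a subgroup of $G$, and this map is a surjective group homomorphism $\pi_1(M,x_0)\to \mathrm{Hol}_{p_0}(\hat{\mathcal A})$, where the product $[c_1][c_2]$ in $\pi_1(M,x_0)$ is the class of the loop that runs first through $c_2$ and then through $c_1$. -/

import Mathlib

open scoped Manifold ContDiff
open Set

namespace FlatBundle

section PrincipalBundle

variable {EM EG EP : Type*}
  [NormedAddCommGroup EM] [NormedSpace ℝ EM]
  [NormedAddCommGroup EG] [NormedSpace ℝ EG]
  [NormedAddCommGroup EP] [NormedSpace ℝ EP]
  {M G P : Type*}
  [TopologicalSpace M] [ChartedSpace EM M]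
  [TopologicalSpace G] [ChartedSpace EG G] [Group G]
  [TopologicalSpace P] [ChartedSpace EP P] [IsManifold 𝓘(ℝ, EP) ∞ P] [MulAction Gᵐᵒᵖ P]

/-- `proj : P → M` is a smooth principal `G`-bundle. The right action `p · g` of `G` on `P` is
written `MulOpposite.op g • p`. It is smooth, preserves the fibres of `proj`, and around every
point of `M` there is a smooth trivialization `proj ⁻¹' U ≅ U × G` which intertwines it with the
right multiplication of `G` on the second factor (so that it is free, and transitive on each
fibre). -/
structure IsPrincipalBundle (EM EG EP : Type*)
    [NormedAddCommGroup EM] [NormedSpace ℝ EM]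
    [NormedAddCommGroup EG] [NormedSpace ℝ EG]
    [NormedAddCommGroup EP] [NormedSpace ℝ EP]
    {M G P : Type*}
    [TopologicalSpace M] [ChartedSpace EM M]
    [TopologicalSpace G] [ChartedSpace EG G] [Group G]
    [TopologicalSpace P] [ChartedSpace EP P] [MulAction Gᵐᵒᵖ P]
    (proj : P → M) : Prop where
  contMDiff_proj : ContMDiff 𝓘(ℝ, EP) 𝓘(ℝ, EM) ∞ proj
  contMDiff_act : ContMDiff (𝓘(ℝ, EP).prod 𝓘(ℝ, EG)) 𝓘(ℝ, EP) ∞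
    (fun q : P × G => MulOpposite.op q.2 • q.1)
  proj_act : ∀ (p : P) (g : G), proj (MulOpposite.op g • p) = proj p
  exists_trivialization : ∀ x : M, ∃ e : Bundle.Trivialization G proj, x ∈ e.baseSet ∧
    ContMDiffOn 𝓘(ℝ, EP) (𝓘(ℝ, EM).prod 𝓘(ℝ, EG)) ∞ e e.source ∧
    ContMDiffOn (𝓘(ℝ, EM).prod 𝓘(ℝ, EG)) 𝓘(ℝ, EP) ∞ e.toOpenPartialHomeomorph.symm e.target ∧
    ∀ p ∈ e.source, ∀ g : G, e (MulOpposite.op g • p) = ((e p).1, (e p).2 * g)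

/-- The adjoint action `Ad g` of `g : G` on the Lie algebra of `G`: the differential at the
identity of the conjugation `h ↦ g * h * g⁻¹`. -/
noncomputable def Ad (EG : Type*) [NormedAddCommGroup EG] [NormedSpace ℝ EG]
    {G : Type*} [TopologicalSpace G] [ChartedSpace EG G] [Group G]
    (g : G) (A : GroupLieAlgebra 𝓘(ℝ, EG) G) : GroupLieAlgebra 𝓘(ℝ, EG) G :=
  mfderiv 𝓘(ℝ, EG) 𝓘(ℝ, EG) (fun h : G => g * h * g⁻¹) 1 A

/-- The fundamental vector field on `P` generated by `A` in the Lie algebra of `G`: its value at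
`p` is the derivative at the identity of `g ↦ p · g` in the direction `A`. -/
noncomputable def fundamentalField (EP : Type*) [NormedAddCommGroup EP] [NormedSpace ℝ EP]
    {P : Type*} [TopologicalSpace P] [ChartedSpace EP P] [MulAction Gᵐᵒᵖ P]
    (A : GroupLieAlgebra 𝓘(ℝ, EG) G) (p : P) : TangentSpace 𝓘(ℝ, EP) p :=
  mfderiv 𝓘(ℝ, EG) 𝓘(ℝ, EP) (fun g : G => MulOpposite.op g • p) 1 A

variable (EG EP G P) in
/-- A connection on `P` (the global form of a gauge potential): a smooth one-form `θ` on `P` with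
values in the Lie algebra of `G` which reproduces the generators of the fundamental vector fields
and satisfies `R_g^* θ = Ad (g⁻¹) θ`. Smoothness of `θ` is smoothness as a function on the total
space of the tangent bundle. -/
structure Connection where
  form : ∀ p : P, TangentSpace 𝓘(ℝ, EP) p →L[ℝ] GroupLieAlgebra 𝓘(ℝ, EG) G
  smooth : ContMDiff (M' := EG) 𝓘(ℝ, EP).tangent 𝓘(ℝ, EG) ∞
    (fun v : TangentBundle 𝓘(ℝ, EP) P => (form v.proj v.snd : EG))
  form_fundamentalField : ∀ (p : P) (A : GroupLieAlgebra 𝓘(ℝ, EG) G),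
    form p (fundamentalField EP A p) = A
  form_act : ∀ (g : G) (p : P) (v : TangentSpace 𝓘(ℝ, EP) p),
    form (MulOpposite.op g • p)
      (mfderiv 𝓘(ℝ, EP) 𝓘(ℝ, EP) (fun q : P => MulOpposite.op g • q) p v) =
      Ad EG g⁻¹ (form p v)

/-- A vector field `X` on `P` is smooth on `U`. -/
def SmoothFieldOn (X : ∀ p : P, TangentSpace 𝓘(ℝ, EP) p) (U : Set P) : Prop :=
  ContMDiffOn 𝓘(ℝ, EP) 𝓘(ℝ, EP).tangent ∞
    (fun p : P => (⟨p, X p⟩ : TangentBundle 𝓘(ℝ, EP) P)) U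

/-- The derivative at `p` of the Lie algebra valued function `q ↦ θ (Y q)` along `X`. -/
noncomputable def Connection.derivAlong (θ : Connection EG EP G P)
    (X Y : ∀ p : P, TangentSpace 𝓘(ℝ, EP) p) (p : P) : GroupLieAlgebra 𝓘(ℝ, EG) G :=
  mfderiv (M' := EG) 𝓘(ℝ, EP) 𝓘(ℝ, EG) (fun q : P => (θ.form q (Y q) : EG)) p (X p)

/-- The curvature `Ω = dθ + ½ [θ, θ]` of a connection, evaluated on two vector fields:
`Ω(X, Y) = X (θ Y) - Y (θ X) - θ [X, Y] + [θ X, θ Y]`. -/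
noncomputable def Connection.curvature (θ : Connection EG EP G P)
    (X Y : ∀ p : P, TangentSpace 𝓘(ℝ, EP) p) (p : P) : GroupLieAlgebra 𝓘(ℝ, EG) G :=
  θ.derivAlong X Y p - θ.derivAlong Y X p
    - θ.form p (VectorField.mlieBracket 𝓘(ℝ, EP) X Y p)
    + ⁅θ.form p (X p), θ.form p (Y p)⁆

/-- The connection is flat: its curvature vanishes on all (locally defined) smooth vector
fields. -/
def Connection.IsFlat (θ : Connection EG EP G P) : Prop :=
  ∀ (U : Set P), IsOpen U → ∀ X Y : ∀ p : P, TangentSpace 𝓘(ℝ, EP) p,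
    SmoothFieldOn X U → SmoothFieldOn Y U → ∀ p ∈ U, θ.curvature X Y p = 0

/-- A path in a manifold is piecewise `C^1`: there is a subdivision of `[0, 1]` on each closed
interval of which it is `C^1` (with one-sided derivatives at the end points). -/
def IsPiecewiseC1 (E : Type*) [NormedAddCommGroup E] [NormedSpace ℝ E]
    {N : Type*} [TopologicalSpace N] [ChartedSpace E N] {x y : N} (c : Path x y) : Prop :=
  ∃ (n : ℕ) (t : ℕ → ℝ), Monotone t ∧ t 0 = 0 ∧ t n = 1 ∧
    ∀ i < n, ContMDiffOn 𝓘(ℝ) 𝓘(ℝ, E) 1 c.extend (Icc (t i) (t (i + 1)))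

/-- A path in `P` is horizontal: it is piecewise `C^1` and its velocity is annihilated by the
connection form wherever it exists. -/
def Connection.IsHorizontal (θ : Connection EG EP G P) {p q : P} (c : Path p q) : Prop :=
  IsPiecewiseC1 EP c ∧ ∀ s ∈ Ioo (0 : ℝ) 1,
    MDifferentiableAt 𝓘(ℝ) 𝓘(ℝ, EP) c.extend s →
      θ.form (c.extend s) (mfderiv 𝓘(ℝ) 𝓘(ℝ, EP) c.extend s (1 : ℝ)) = 0

/-- `g` is the holonomy of the loop `c` with respect to the reference point `p₀`: the loop has a
horizontal lift which starts at `p₀` and ends at `p₀ · g`. -/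
def Connection.IsHolonomy (θ : Connection EG EP G P) (proj : P → M) (p₀ : P) {x₀ : M}
    (c : Path x₀ x₀) (g : G) : Prop :=
  ∃ c' : Path p₀ (MulOpposite.op g • p₀), θ.IsHorizontal c' ∧ ∀ s, proj (c' s) = c s

variable (EM) in
/-- The underlying set of the holonomy group with reference point `p₀`: the holonomies of all
piecewise `C^1` loops based at `x₀`. -/
def Connection.holonomySet (θ : Connection EG EP G P) (proj : P → M) (p₀ : P) (x₀ : M) : Set G :=
  {g | ∃ c : Path x₀ x₀, IsPiecewiseC1 EM c ∧ θ.IsHolonomy proj p₀ c g}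

end PrincipalBundle

end FlatBundle

/-! Flatness makes the horizontal distribution, the kernel of `θ`, involutive: on horizontal fields
the curvature is `-θ [X, Y]`. By Frobenius, a horizontal local section of `proj` passes through
every point of `P` (`Connection.exists_isFlatSection`). If `s` and `s · g` are both horizontal, then
`θ (d(s · g)) = Ad (g⁻¹) θ (ds) + g⁻¹ dg` forces `dg = 0`, so two flat sections differ on their
overlap by a locally constant function with values in `G`
(`Connection.IsFlatSection.eventually_eq`). The flat sections therefore glue to a covering of `M`
whose fibre is `G` made discrete (`Connection.leafBundle`), and this covering maps to `P` by
`Connection.leafPoint`. Path lifting in the covering gives horizontal lifts, and the monodromy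
theorem gives homotopic loops lifts with a common end point (`Connection.exists_isLeafLift`).

Uniqueness of the holonomy does not need flatness. Two horizontal lifts of one curve differ by a
curve `g` in `G`, and the same formula gives `g' = 0` off a finite set, so `g` is constant
(`Connection.op_smul_eq_of_isHorizontalOffFinite`). Multiplicativity follows: if `d₁`, `d₂` lift
`c₁`, `c₂` with holonomies `g₁`, `g₂`, then `d₂` followed by `d₁ · g₂` lifts `c₂` followed by `c₁`
and ends at `p₀ · (g₁ g₂)`.

Frobenius is used as solvability of `Df (x) = F (x, f x)`: the equation is solved along rays by
Picard-Lindelöf, and a Grönwall estimate shows that integrability gives the values at time one the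
right derivative. Piecewise `C^1` representatives come from straight segments in charts and the
connectedness of the unit interval. -/

namespace FlatBundle

/-! ### Frobenius theorem for total differential equations -/

section Frobenius

open Metric

variable {E E' : Type*} [NormedAddCommGroup E] [NormedSpace ℝ E]
  [NormedAddCommGroup E'] [NormedSpace ℝ E']

/-- The Picard-Lindelöf theorem, recording that the solution stays in the ball on which the
vector field is controlled. -/
theorem exists_solution_mem_closedBall [CompleteSpace E'] {f : ℝ → E' → E'} {tmin tmax : ℝ}
    {t₀ : Icc tmin tmax} {x₀ : E'} {a L K : NNReal} (hf : IsPicardLindelof f t₀ x₀ a 0 L K) :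
    ∃ α : ℝ → E', α t₀ = x₀ ∧ ∀ t ∈ Icc tmin tmax, α t ∈ closedBall x₀ a ∧
      HasDerivWithinAt α (f t (α t)) (Icc tmin tmax) t := by
  have hx : x₀ ∈ closedBall x₀ ((0 : NNReal) : ℝ) := by simp
  obtain ⟨α, hα⟩ := ODE.FunSpace.exists_isFixedPt_next hf hx
  have hmem : ∀ t, α.compProj t ∈ closedBall x₀ a := fun t =>
    α.compProj_mem_closedBall hf.mul_max_le
  have hfix := (ODE.FunSpace.isFixedPt_next_iff hf hx).1 hα
  have heq : ∀ t ∈ Icc tmin tmax, α.compProj t = ODE.picard f t₀ x₀ α.compProj t := by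
    intro t ht
    rw [ODE.FunSpace.compProj_of_mem ht]
    exact hfix ⟨t, ht⟩
  refine ⟨α.compProj, ?_, fun t ht => ⟨hmem t, ?_⟩⟩
  · rw [heq _ t₀.2, ODE.picard_apply₀]
  · have := ODE.hasDerivWithinAt_picard_Icc t₀.2 hf.continuousOn_uncurry
      α.continuous_compProj.continuousOn (fun t _ => hmem t) x₀ ht
    exact this.congr heq (heq t ht)

/-- With zero initial error the Grönwall bound is linear in the defect. This brings out the factor
`‖h‖ ^ 2` in the estimate below. -/
theorem gronwallBound_zero_mul (K ε x : ℝ) :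
    gronwallBound 0 K ε x = ε * gronwallBound 0 K 1 x := by
  unfold gronwallBound
  split_ifs <;> ring

/-- Two solutions of the family of radial equations `z' = F (x₀ + t ξ, z) ξ` of a completely
integrable total differential equation differ to first order by `F`. -/
theorem norm_radial_solution_sub_le {F : E × E' → E →L[ℝ] E'}
    {F' : E × E' → E × E' →L[ℝ] E →L[ℝ] E'} {x₀ : E} {y₀ : E'} {R ρ : ℝ} {K : NNReal}
    (hρ : 0 ≤ ρ) (hρR : ρ ≤ R) (hK1 : 1 ≤ K)
    (hd : ∀ z ∈ closedBall x₀ R ×ˢ closedBall y₀ R, HasFDerivAt F (F' z) z)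
    (hK : ∀ z ∈ closedBall x₀ R ×ˢ closedBall y₀ R, ‖F z‖ ≤ K)
    (hK' : ∀ z ∈ closedBall x₀ R ×ˢ closedBall y₀ R, ‖F' z‖ ≤ K)
    (hL' : LipschitzOnWith K F' (closedBall x₀ R ×ˢ closedBall y₀ R))
    (hint : ∀ z ∈ closedBall x₀ R ×ˢ closedBall y₀ R, ∀ u v,
      F' z (u, F z u) v = F' z (v, F z v) u)
    {ξ h : E} (hξ : ‖ξ‖ ≤ ρ) (hξh : ‖ξ + h‖ ≤ ρ) (hh : K * ‖h‖ ≤ R / 2) {z z₁ : ℝ → E'}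
    (hz0 : z 0 = y₀) (hz10 : z₁ 0 = y₀)
    (hz : ∀ t ∈ Icc (0 : ℝ) 1, z t ∈ closedBall y₀ (R / 2) ∧
      HasDerivWithinAt z (F (x₀ + t • ξ, z t) ξ) (Icc 0 1) t)
    (hz₁ : ∀ t ∈ Icc (0 : ℝ) 1, z₁ t ∈ closedBall y₀ (R / 2) ∧
      HasDerivWithinAt z₁ (F (x₀ + t • (ξ + h), z₁ t) (ξ + h)) (Icc 0 1) t) :
    ‖z₁ 1 - z 1 - F (x₀ + ξ, z 1) h‖ ≤
      gronwallBound 0 (K * ρ) 1 1 * (K ^ 3 * ρ + K ^ 2) * ‖h‖ ^ 2 := by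
  have hR : 0 ≤ R := hρ.trans hρR
  have hK1' : (1 : ℝ) ≤ K := by exact_mod_cast hK1
  set B := closedBall x₀ R ×ˢ closedBall y₀ R with hB
  have hBc : Convex ℝ B := (convex_closedBall _ _).prod (convex_closedBall _ _)
  have hx : ∀ t ∈ Icc (0 : ℝ) 1, ∀ η : E, ‖η‖ ≤ ρ → x₀ + t • η ∈ closedBall x₀ R := by
    intro t ht η hη
    rw [mem_closedBall, dist_eq_norm, add_sub_cancel_left, norm_smul, Real.norm_eq_abs,
      abs_of_nonneg ht.1]
    nlinarith [ht.2, norm_nonneg η]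
  have hRR : closedBall y₀ (R / 2) ⊆ closedBall y₀ R := closedBall_subset_closedBall (by linarith)
  set γ : ℝ → E × E' := fun t => (x₀ + t • ξ, z t) with hγ
  have hγB : ∀ t ∈ Icc (0 : ℝ) 1, γ t ∈ B := fun t ht => ⟨hx t ht ξ hξ, hRR (hz t ht).1⟩
  -- The expected first-order perturbation of `z`. It will be shown to solve the equation of `z₁` up
  -- to an error of order `‖h‖ ^ 2`, and `w 1` is exactly the claimed linear approximation.
  set w : ℝ → E' := fun t => z t + t • F (γ t) h with hw
  have hwB : ∀ t ∈ Icc (0 : ℝ) 1, w t ∈ closedBall y₀ R := by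
    intro t ht
    have h1 := (hz t ht).1
    rw [mem_closedBall, dist_eq_norm] at h1 ⊢
    have h2 : ‖t • F (γ t) h‖ ≤ K * ‖h‖ := by
      rw [norm_smul, Real.norm_eq_abs, abs_of_nonneg ht.1]
      have := (F (γ t)).le_of_opNorm_le (hK _ (hγB t ht)) h
      nlinarith [ht.2, norm_nonneg (F (γ t) h)]
    calc ‖w t - y₀‖ = ‖(z t - y₀) + t • F (γ t) h‖ := by rw [hw]; exact congrArg _ (add_sub_right_comm _ _ _)
      _ ≤ R / 2 + R / 2 := (norm_add_le _ _).trans (add_le_add h1 (h2.trans hh))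
      _ = R := by ring
  have hγd : ∀ t ∈ Icc (0 : ℝ) 1, HasDerivWithinAt γ (ξ, F (γ t) ξ) (Icc 0 1) t := by
    intro t ht
    refine HasDerivWithinAt.prodMk ?_ (hz t ht).2
    simpa using ((hasDerivWithinAt_id t (Icc (0 : ℝ) 1)).smul_const ξ).const_add x₀
  set w' : ℝ → E' := fun t => F (γ t) ξ + (F (γ t) h + t • F' (γ t) (ξ, F (γ t) ξ) h) with hw'
  have hwd : ∀ t ∈ Icc (0 : ℝ) 1, HasDerivWithinAt w (w' t) (Icc 0 1) t := by
    intro t ht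
    have h1 : HasDerivWithinAt (fun t => F (γ t)) (F' (γ t) (ξ, F (γ t) ξ)) (Icc 0 1) t :=
      (hd _ (hγB t ht)).comp_hasDerivWithinAt t (hγd t ht)
    have h2 := h1.clm_apply (hasDerivWithinAt_const t (Icc (0 : ℝ) 1) h)
    have h3 := (hasDerivWithinAt_id t (Icc (0 : ℝ) 1)).smul h2
    refine ((hz t ht).2.add h3).congr_deriv ?_
    simp [hw', hγ]
    abel
  -- The first summand comes from the Taylor remainder of `F` between `γ t` and `b`, applied to `ξ +
  -- h`; the second from the term `t • F' (γ t) (h, F (γ t) h) h`, quadratic in `h`.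
  set C : ℝ := K ^ 3 * ρ + K ^ 2 with hC
  have hbound : ∀ t ∈ Icc (0 : ℝ) 1,
      dist (w' t) (F (x₀ + t • (ξ + h), w t) (ξ + h)) ≤ C * ‖h‖ ^ 2 := by
    intro t ht
    set b : E × E' := (x₀ + t • (ξ + h), w t) with hb
    have hbB : b ∈ B := ⟨hx t ht _ hξh, hwB t ht⟩
    have hbγ : b - γ t = t • (h, F (γ t) h) := by
      simp only [hb, hγ, hw, Prod.mk_sub_mk, Prod.smul_mk, smul_add]
      congr 1 <;> abel
    have hFh := (F (γ t)).le_of_opNorm_le (hK _ (hγB t ht)) h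
    have hpair : ‖(h, F (γ t) h)‖ ≤ K * ‖h‖ := by
      rw [Prod.norm_mk]
      refine max_le ?_ hFh
      nlinarith [norm_nonneg h]
    have hbn : ‖b - γ t‖ ≤ K * ‖h‖ := by
      rw [hbγ, norm_smul, Real.norm_eq_abs, abs_of_nonneg ht.1]
      nlinarith [ht.2, norm_nonneg (h, F (γ t) h)]
    have hseg : segment ℝ (γ t) b ⊆ B := hBc.segment_subset (hγB t ht) hbB
    have hrem : ‖F b - F (γ t) - F' (γ t) (b - γ t)‖ ≤ (K * (K * ‖h‖)) * ‖b - γ t‖ := by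
      refine Convex.norm_image_sub_le_of_norm_hasFDerivWithin_le' (𝕜 := ℝ)
        (f' := F') (s := segment ℝ (γ t) b)
        (fun y hy => (hd y (hseg hy)).hasFDerivWithinAt) (fun y hy => ?_)
        (convex_segment _ _) (left_mem_segment _ _ _) (right_mem_segment _ _ _)
      have h1 := hL'.norm_sub_le (hseg hy) (hγB t ht)
      have h2 : ‖y - γ t‖ ≤ ‖b - γ t‖ := by
        obtain ⟨c, hc, rfl⟩ := (segment_eq_image' ℝ (γ t) b).subset hy
        simp only [add_sub_cancel_left, norm_smul, Real.norm_eq_abs, abs_of_nonneg hc.1]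
        nlinarith [hc.2, norm_nonneg (b - γ t)]
      refine h1.trans ?_
      have := h2.trans hbn
      gcongr
    have hrem' : ‖F b - F (γ t) - F' (γ t) (b - γ t)‖ ≤ K ^ 3 * ‖h‖ ^ 2 := by
      refine hrem.trans ?_
      calc (K * (K * ‖h‖)) * ‖b - γ t‖ ≤ (K * (K * ‖h‖)) * (K * ‖h‖) := by gcongr
        _ = K ^ 3 * ‖h‖ ^ 2 := by ring
    -- Integrability enters here: `F' (ξ, F ξ) h` in `w'` cancels against `F' (h, F h) ξ` in the
    -- expansion of `F b ξ`, so no term linear in `h` is left.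
    have hkey : w' t - F b (ξ + h) = -((F b - F (γ t) - F' (γ t) (b - γ t)) (ξ + h)) -
        t • F' (γ t) (h, F (γ t) h) h := by
      have hi := hint _ (hγB t ht) ξ h
      rw [hbγ, map_smul]
      simp only [hw', sub_apply, smul_apply, map_add, hi]
      abel
    rw [dist_eq_norm, hkey]
    have e1 : ‖(F b - F (γ t) - F' (γ t) (b - γ t)) (ξ + h)‖ ≤ K ^ 3 * ‖h‖ ^ 2 * ρ := by
      refine ((ContinuousLinearMap.le_opNorm _ _).trans ?_)
      gcongr
    have e2 : ‖t • F' (γ t) (h, F (γ t) h) h‖ ≤ K * (K * ‖h‖) * ‖h‖ := by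
      rw [norm_smul, Real.norm_eq_abs, abs_of_nonneg ht.1]
      have a1 := (F' (γ t)).le_of_opNorm_le (hK' _ (hγB t ht)) (h, F (γ t) h)
      have a2 : ‖F' (γ t) (h, F (γ t) h) h‖ ≤ K * (K * ‖h‖) * ‖h‖ := by
        refine (ContinuousLinearMap.le_opNorm _ _).trans ?_
        gcongr
        exact a1.trans (by gcongr)
      nlinarith [ht.2, norm_nonneg (F' (γ t) (h, F (γ t) h) h)]
    calc _ ≤ K ^ 3 * ‖h‖ ^ 2 * ρ + K * (K * ‖h‖) * ‖h‖ := by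
          refine (norm_sub_le _ _).trans ?_
          rw [norm_neg]
          exact add_le_add e1 e2
      _ = C * ‖h‖ ^ 2 := by rw [hC]; ring
  have hsub : Ico (0 : ℝ) 1 ⊆ Icc 0 1 := Ico_subset_Icc_self
  have hici : ∀ {g : ℝ → E'} {g' : E'} {t : ℝ}, t ∈ Ico (0 : ℝ) 1 →
      HasDerivWithinAt g g' (Icc 0 1) t → HasDerivWithinAt g g' (Ici t) t := by
    intro g g' t ht hg
    refine hg.mono_of_mem_nhdsWithin ?_
    exact Filter.mem_of_superset (Icc_mem_nhdsGE ht.2) (Icc_subset_Icc_left ht.1)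
  have hLip : ∀ t ∈ Ico (0 : ℝ) 1, LipschitzOnWith (K * ⟨ρ, hρ⟩)
      (fun y => F (x₀ + t • (ξ + h), y) (ξ + h)) (closedBall y₀ R) := by
    intro t ht
    refine LipschitzOnWith.of_dist_le_mul fun y hy y' hy' => ?_
    have h1 : ‖F (x₀ + t • (ξ + h), y) - F (x₀ + t • (ξ + h), y')‖ ≤
        K * ‖((x₀ + t • (ξ + h), y) : E × E') - (x₀ + t • (ξ + h), y')‖ :=
      hBc.norm_image_sub_le_of_norm_hasFDerivWithin_le
        (fun z hz => (hd z hz).hasFDerivWithinAt) hK' ⟨hx t (hsub ht) _ hξh, hy'⟩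
        ⟨hx t (hsub ht) _ hξh, hy⟩
    rw [Prod.mk_sub_mk, sub_self, Prod.norm_mk, norm_zero, max_eq_right (norm_nonneg _)] at h1
    rw [dist_eq_norm, dist_eq_norm, ← sub_apply]
    refine (ContinuousLinearMap.le_opNorm _ _).trans ?_
    have : ((K * ⟨ρ, hρ⟩ : NNReal) : ℝ) = K * ρ := rfl
    rw [this]
    calc _ ≤ (K * ‖y - y'‖) * ρ := by gcongr
      _ = _ := by ring
  have hgron := dist_le_of_approx_trajectories_ODE_of_mem (f := z₁) (g := w) (g' := w')
    (δ := 0) (εf := 0) (εg := C * ‖h‖ ^ 2) (a := 0) (b := 1) hLip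
    (fun t ht => (hz₁ t ht).2.continuousWithinAt)
    (fun t ht => hici ht (hz₁ t (hsub ht)).2) (fun t ht => by simp)
    (fun t ht => hRR (hz₁ t (hsub ht)).1)
    (fun t ht => (hwd t ht).continuousWithinAt)
    (fun t ht => hici ht (hwd t (hsub ht)))
    (fun t ht => hbound t (hsub ht)) (fun t ht => hwB t (hsub ht))
    (by simp [hw, hz0, hz10]) 1 (by simp)
  rw [dist_eq_norm, zero_add, sub_zero, gronwallBound_zero_mul] at hgron
  have e : z₁ 1 - w 1 = z₁ 1 - z 1 - F (x₀ + ξ, z 1) h := by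
    simp only [hw, hγ, one_smul]; abel
  rw [e] at hgron
  refine hgron.trans (le_of_eq ?_)
  have : ((K * ⟨ρ, hρ⟩ : NNReal) : ℝ) = K * ρ := rfl
  rw [this]
  ring

/-- The Frobenius theorem for completely integrable total differential equations
`Df (x) = F (x, f x)`. -/
theorem exists_hasFDerivAt_eq_of_integrable [CompleteSpace E'] {F : E × E' → E →L[ℝ] E'}
    {Ω : Set (E × E')} (hΩ : IsOpen Ω) (hF : ContDiffOn ℝ 2 F Ω)
    (hint : ∀ z ∈ Ω, ∀ u v, fderiv ℝ F z (u, F z u) v = fderiv ℝ F z (v, F z v) u)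
    {x₀ : E} {y₀ : E'} (h₀ : (x₀, y₀) ∈ Ω) :
    ∃ (f : E → E') (U : Set E), IsOpen U ∧ x₀ ∈ U ∧ f x₀ = y₀ ∧
      ∀ x ∈ U, (x, f x) ∈ Ω ∧ HasFDerivAt f (F (x, f x)) x := by
  have hFat : ContDiffAt ℝ 2 F (x₀, y₀) := hF.contDiffAt (hΩ.mem_nhds h₀)
  have hF'at : ContDiffAt ℝ 1 (fderiv ℝ F) (x₀, y₀) :=
    hFat.fderiv_right (by norm_num)
  obtain ⟨K₁, s₁, hs₁, hL₁⟩ := hF'at.exists_lipschitzOnWith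
  have hc : ∀ᶠ z in nhds (x₀, y₀), ‖F z‖ < ‖F (x₀, y₀)‖ + 1 :=
    hFat.continuousAt.norm.eventually_lt continuousAt_const (lt_add_one _)
  have hc' : ∀ᶠ z in nhds (x₀, y₀), ‖fderiv ℝ F z‖ < ‖fderiv ℝ F (x₀, y₀)‖ + 1 := by
    have h : ContinuousAt (fun z => ‖fderiv ℝ F z‖) (x₀, y₀) :=
      (continuous_norm (E := E × E' →L[ℝ] E →L[ℝ] E')).continuousAt.comp hF'at.continuousAt
    exact h.eventually_lt continuousAt_const (lt_add_one _)
  obtain ⟨R, hR, hball⟩ := Metric.nhds_basis_closedBall.mem_iff.1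
    (Filter.inter_mem (Filter.inter_mem (hΩ.mem_nhds h₀) hs₁) (Filter.inter_mem hc hc'))
  rw [← closedBall_prod_same] at hball
  -- A single constant majorizing 1, the Lipschitz constant of the derivative, and the norms of `F`
  -- and of its derivative on the chosen ball.
  set K : NNReal := 1 + K₁ + (‖F (x₀, y₀)‖₊ + 1) + (‖fderiv ℝ F (x₀, y₀)‖₊ + 1) with hKdef
  have hKr : (K : ℝ) = 1 + K₁ + (‖F (x₀, y₀)‖ + 1) + (‖fderiv ℝ F (x₀, y₀)‖ + 1) := rfl
  have hK0 : (0 : ℝ) < K := by rw [hKr]; positivity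
  have hK1 : 1 ≤ K := by rw [← NNReal.coe_le_coe, hKr, NNReal.coe_one]
                         have := K₁.coe_nonneg
                         have := norm_nonneg (F (x₀, y₀))
                         have := norm_nonneg (fderiv ℝ F (x₀, y₀))
                         linarith
  have hK1' : (1 : ℝ) ≤ K := by exact_mod_cast hK1
  have hd : ∀ z ∈ closedBall x₀ R ×ˢ closedBall y₀ R, HasFDerivAt F (fderiv ℝ F z) z :=
    fun z hz => ((hF.contDiffAt (hΩ.mem_nhds (hball hz).1.1)).differentiableAt
      (by norm_num)).hasFDerivAt
  have hK : ∀ z ∈ closedBall x₀ R ×ˢ closedBall y₀ R, ‖F z‖ ≤ K := by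
    intro z hz
    refine (le_of_lt (hball hz).2.1).trans ?_
    rw [hKr]
    have := norm_nonneg (fderiv ℝ F (x₀, y₀))
    have := K₁.coe_nonneg
    linarith
  have hK' : ∀ z ∈ closedBall x₀ R ×ˢ closedBall y₀ R, ‖fderiv ℝ F z‖ ≤ K := by
    intro z hz
    refine (le_of_lt (hball hz).2.2).trans ?_
    rw [hKr]
    have := norm_nonneg (F (x₀, y₀))
    have := K₁.coe_nonneg
    linarith
  have hL' : LipschitzOnWith K (fderiv ℝ F) (closedBall x₀ R ×ˢ closedBall y₀ R) := by
    refine (hL₁.mono fun z hz => (hball hz).1.2).weaken ?_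
    rw [← NNReal.coe_le_coe, hKr]
    have := norm_nonneg (F (x₀, y₀))
    have := norm_nonneg (fderiv ℝ F (x₀, y₀))
    linarith
  have hint' : ∀ z ∈ closedBall x₀ R ×ˢ closedBall y₀ R, ∀ u v,
      fderiv ℝ F z (u, F z u) v = fderiv ℝ F z (v, F z v) u :=
    fun z hz => hint z (hball hz).1.1
  -- Radial solutions have speed at most `K * ρ = R / 2`, so up to time one they stay in the ball of
  -- radius `R / 2`. The other half of the radius is room for the correction term of the comparison
  -- curve.
  set ρ : ℝ := R / (2 * K) with hρdef
  have hρ : 0 < ρ := by positivity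
  have hKρ : K * ρ = R / 2 := by rw [hρdef]; field_simp
  have hρR : ρ ≤ R := by nlinarith
  have hsol : ∀ x ∈ closedBall x₀ ρ, ∃ z : ℝ → E', z 0 = y₀ ∧ ∀ t ∈ Icc (0 : ℝ) 1,
      z t ∈ closedBall y₀ (R / 2) ∧
      HasDerivWithinAt z (F (x₀ + t • (x - x₀), z t) (x - x₀)) (Icc 0 1) t := by
    intro x hx
    rw [mem_closedBall, dist_eq_norm] at hx
    have hmem : ∀ t ∈ Icc (0 : ℝ) 1, x₀ + t • (x - x₀) ∈ closedBall x₀ R := by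
      intro t ht
      rw [mem_closedBall, dist_eq_norm, add_sub_cancel_left, norm_smul, Real.norm_eq_abs,
        abs_of_nonneg ht.1]
      nlinarith [ht.2, norm_nonneg (x - x₀)]
    have hsubR : closedBall y₀ (R / 2) ⊆ closedBall y₀ R :=
      closedBall_subset_closedBall (by linarith)
    have hPL : IsPicardLindelof (fun t y => F (x₀ + t • (x - x₀), y) (x - x₀))
        (⟨0, by simp⟩ : Icc (0 : ℝ) 1) y₀ (R / 2).toNNReal 0 (K * ⟨ρ, hρ.le⟩)
        (K * ⟨ρ, hρ.le⟩) := by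
      refine ⟨fun t ht => ?_, fun y hy => ?_, fun t ht y hy => ?_, ?_⟩ <;>
        try rw [Real.coe_toNNReal _ (by positivity : 0 ≤ R / 2)] at *
      · refine LipschitzOnWith.of_dist_le_mul fun y hy y' hy' => ?_
        have h1 : ‖F (x₀ + t • (x - x₀), y) - F (x₀ + t • (x - x₀), y')‖ ≤
            K * ‖((x₀ + t • (x - x₀), y) : E × E') - (x₀ + t • (x - x₀), y')‖ :=
          ((convex_closedBall _ _).prod
            (convex_closedBall _ _)).norm_image_sub_le_of_norm_hasFDerivWithin_le
            (fun z hz => (hd z hz).hasFDerivWithinAt) hK' ⟨hmem t ht, hsubR hy'⟩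
            ⟨hmem t ht, hsubR hy⟩
        rw [Prod.mk_sub_mk, sub_self, Prod.norm_mk, norm_zero,
          max_eq_right (norm_nonneg _)] at h1
        rw [dist_eq_norm, dist_eq_norm, ← sub_apply]
        refine (ContinuousLinearMap.le_opNorm _ _).trans ?_
        have : ((K * ⟨ρ, hρ.le⟩ : NNReal) : ℝ) = K * ρ := rfl
        rw [this]
        calc _ ≤ (K * ‖y - y'‖) * ρ := by gcongr
          _ = _ := by ring
      · have hFc : ContinuousOn F (closedBall x₀ R ×ˢ closedBall y₀ R) :=
          fun z hz => (hd z hz).continuousAt.continuousWithinAt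
        have : ContinuousOn (fun t : ℝ => F (x₀ + t • (x - x₀), y)) (Icc 0 1) :=
          hFc.comp (by fun_prop) fun t ht => ⟨hmem t ht, hsubR hy⟩
        exact this.clm_apply continuousOn_const
      · have := hK _ (mk_mem_prod (hmem t ht) (hsubR hy))
        have e : ((K * ⟨ρ, hρ.le⟩ : NNReal) : ℝ) = K * ρ := rfl
        rw [e]
        refine (ContinuousLinearMap.le_opNorm _ _).trans ?_
        gcongr
      · have e : ((K * ⟨ρ, hρ.le⟩ : NNReal) : ℝ) = K * ρ := rfl
        rw [e, hKρ]
        simp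
    obtain ⟨z, hz0, hz⟩ := exists_solution_mem_closedBall hPL
    rw [Real.coe_toNNReal _ (by positivity : 0 ≤ R / 2)] at hz
    exact ⟨z, hz0, hz⟩
  choose! Z hZ0 hZ using hsol
  have hx₀ : x₀ ∈ closedBall x₀ ρ := mem_closedBall_self hρ.le
  refine ⟨fun x => Z x 1, ball x₀ ρ, isOpen_ball, mem_ball_self hρ, ?_, fun x hx => ⟨?_, ?_⟩⟩
  · have hconst : ∀ t ∈ Icc (0 : ℝ) 1, Z x₀ t = Z x₀ 0 := by
      refine constant_of_has_deriv_right_zero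
        (fun t ht => (hZ x₀ hx₀ t ht).2.continuousWithinAt) fun t ht => ?_
      have := (hZ x₀ hx₀ t (Ico_subset_Icc_self ht)).2
      simp only [sub_self, map_zero] at this
      exact this.mono_of_mem_nhdsWithin
        (Filter.mem_of_superset (Icc_mem_nhdsGE ht.2) (Icc_subset_Icc_left ht.1))
    simpa [hZ0 x₀ hx₀] using hconst 1 (by simp)
  · refine (hball (mk_mem_prod ?_ ?_)).1.1
    · exact closedBall_subset_closedBall hρR (ball_subset_closedBall hx)
    · exact closedBall_subset_closedBall (by linarith)
        (hZ x (ball_subset_closedBall hx) 1 (by simp)).1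
  · rw [hasFDerivAt_iff_isLittleO_nhds_zero]
    have hbig : (fun h => Z (x + h) 1 - Z x 1 - F (x, Z x 1) h) =O[nhds 0]
        fun h => ‖h‖ ^ 2 := by
      refine Asymptotics.IsBigO.of_bound (gronwallBound 0 (K * ρ) 1 1 * (K ^ 3 * ρ + K ^ 2)) ?_
      have hev1 : ∀ᶠ h in nhds (0 : E), x + h ∈ ball x₀ ρ := by
        have : Filter.Tendsto (fun h : E => x + h) (nhds 0) (nhds x) := by
          simpa using (by fun_prop : Continuous fun h : E => x + h).tendsto 0
        exact this (isOpen_ball.mem_nhds hx)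
      have hev2 : ∀ᶠ h in nhds (0 : E), K * ‖h‖ < R / 2 := by
        have : Continuous fun h : E => (K : ℝ) * ‖h‖ := by fun_prop
        exact this.continuousAt.eventually_lt continuousAt_const (by simpa using hR)
      filter_upwards [hev1, hev2] with h hh1 hh2
      have hxm := ball_subset_closedBall hx
      have hxh := ball_subset_closedBall hh1
      have e : x - x₀ + h = x + h - x₀ := by abel
      have := norm_radial_solution_sub_le hρ.le hρR hK1 hd hK hK' hL' hint'
        (ξ := x - x₀) (h := h) (by simpa [dist_eq_norm] using hxm)
        (by rw [e]; simpa [dist_eq_norm] using hxh) hh2.le (hZ0 x hxm) (hZ0 _ hxh)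
        (hZ x hxm) (by simpa only [e] using hZ _ hxh)
      rw [add_sub_cancel] at this
      simpa using this
    refine hbig.trans_isLittleO ?_
    exact (Asymptotics.isLittleO_norm_pow_id one_lt_two)

end Frobenius

/-! ### Flatness in coordinates and horizontal graphs -/

section Integrability

open VectorField

variable {E : Type*} [NormedAddCommGroup E] [NormedSpace ℝ E]
  {EP : Type*} [NormedAddCommGroup EP] [NormedSpace ℝ EP]
  {P : Type*} [TopologicalSpace P] [ChartedSpace EP P]

theorem mfderiv_comp_mfderiv_symm {φ : OpenPartialHomeomorph P E}
    (hφ : ContMDiffOn 𝓘(ℝ, EP) 𝓘(ℝ, E) ∞ φ φ.source)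
    (hφs : ContMDiffOn 𝓘(ℝ, E) 𝓘(ℝ, EP) ∞ φ.symm φ.target) {p : P} (hp : p ∈ φ.source) :
    (mfderiv 𝓘(ℝ, EP) 𝓘(ℝ, E) φ p).comp (mfderiv 𝓘(ℝ, E) 𝓘(ℝ, EP) φ.symm (φ p)) =
        ContinuousLinearMap.id ℝ (TangentSpace 𝓘(ℝ, E) (φ p)) ∧
      (mfderiv 𝓘(ℝ, E) 𝓘(ℝ, EP) φ.symm (φ p)).comp (mfderiv 𝓘(ℝ, EP) 𝓘(ℝ, E) φ p) =
        ContinuousLinearMap.id ℝ (TangentSpace 𝓘(ℝ, EP) p) := by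
  have h1 : HasMFDerivAt 𝓘(ℝ, EP) 𝓘(ℝ, E) φ p (mfderiv 𝓘(ℝ, EP) 𝓘(ℝ, E) φ p) :=
    ((hφ.contMDiffAt (φ.open_source.mem_nhds hp)).mdifferentiableAt (by simp)).hasMFDerivAt
  have h2 : HasMFDerivAt 𝓘(ℝ, E) 𝓘(ℝ, EP) φ.symm (φ p)
      (mfderiv 𝓘(ℝ, E) 𝓘(ℝ, EP) φ.symm (φ p)) :=
    ((hφs.contMDiffAt (φ.open_target.mem_nhds (φ.map_source hp))).mdifferentiableAt
      (by simp)).hasMFDerivAt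
  have h1' : HasMFDerivAt 𝓘(ℝ, EP) 𝓘(ℝ, E) φ (φ.symm (φ p)) (mfderiv 𝓘(ℝ, EP) 𝓘(ℝ, E) φ p) := by
    rw [φ.left_inv hp]; exact h1
  constructor
  · have h := h1'.comp (φ p) h2
    have hid : HasMFDerivAt 𝓘(ℝ, E) 𝓘(ℝ, E) (φ ∘ φ.symm) (φ p)
        (ContinuousLinearMap.id ℝ (TangentSpace 𝓘(ℝ, E) (φ p))) :=
      (hasMFDerivAt_id (φ p)).congr_of_eventuallyEq
        (Filter.eventuallyEq_of_mem (φ.open_target.mem_nhds (φ.map_source hp))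
          fun z hz => φ.right_inv hz)
    exact hasMFDerivAt_unique h hid
  · have h := h2.comp p h1
    have hid : HasMFDerivAt 𝓘(ℝ, EP) 𝓘(ℝ, EP) (φ.symm ∘ φ) p
        (ContinuousLinearMap.id ℝ (TangentSpace 𝓘(ℝ, EP) p)) :=
      (hasMFDerivAt_id p).congr_of_eventuallyEq
        (Filter.eventuallyEq_of_mem (φ.open_source.mem_nhds hp) fun z hz => φ.left_inv hz)
    exact hasMFDerivAt_unique h hid

variable {EG : Type*} [NormedAddCommGroup EG] [NormedSpace ℝ EG]
  {G : Type*} [TopologicalSpace G] [ChartedSpace EG G] [Group G]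
  [IsManifold 𝓘(ℝ, EP) ∞ P] [MulAction Gᵐᵒᵖ P]

/-- A flat connection kills the Lie bracket of two local horizontal vector fields. -/
theorem Connection.form_mlieBracket_eq_zero {θ : Connection EG EP G P} (hflat : θ.IsFlat)
    {U : Set P} (hU : IsOpen U) {X Y : ∀ p : P, TangentSpace 𝓘(ℝ, EP) p}
    (hX : SmoothFieldOn X U) (hY : SmoothFieldOn Y U) (hX0 : ∀ p ∈ U, θ.form p (X p) = 0)
    (hY0 : ∀ p ∈ U, θ.form p (Y p) = 0) {p : P} (hp : p ∈ U) :
    θ.form p (mlieBracket 𝓘(ℝ, EP) X Y p) = 0 := by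
  have key : ∀ X Y : ∀ p : P, TangentSpace 𝓘(ℝ, EP) p, (∀ p ∈ U, θ.form p (Y p) = 0) →
      θ.derivAlong X Y p = 0 := by
    intro X Y hY0
    have : (fun q : P => (θ.form q (Y q) : EG)) =ᶠ[nhds p] fun _ => (0 : EG) :=
      Filter.eventuallyEq_of_mem (hU.mem_nhds hp) fun q hq => hY0 q hq
    have h0 : HasMFDerivAt (M' := EG) 𝓘(ℝ, EP) 𝓘(ℝ, EG) (fun q : P => (θ.form q (Y q) : EG)) p 0 :=
      (hasMFDerivAt_const (0 : EG) p).congr_of_eventuallyEq this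
    exact DFunLike.congr_fun h0.mfderiv (X p)
  have h := hflat U hU X Y hX hY p hp
  unfold Connection.curvature at h
  -- On horizontal fields only the bracket term of the curvature survives.
  rw [key X Y hY0, key Y X hX0, hX0 p hp, hY0 p hp] at h
  have hb : ⁅(0 : GroupLieAlgebra 𝓘(ℝ, EG) G), (0 : GroupLieAlgebra 𝓘(ℝ, EG) G)⁆ = 0 := by
    rw [GroupLieAlgebra.bracket_def]
    have : mulInvariantVectorField (0 : GroupLieAlgebra 𝓘(ℝ, EG) G) = 0 := by
      ext g
      exact map_zero _
    rw [this, mlieBracket_zero_left]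
    rfl
  rw [hb] at h
  simpa using h

/-- The connection form in the coordinates given by `φ`. -/
noncomputable def Connection.localForm (θ : Connection EG EP G P) (φ : OpenPartialHomeomorph P E)
    (z : E) : E →L[ℝ] EG :=
  (θ.form (φ.symm z)).comp (mfderiv 𝓘(ℝ, E) 𝓘(ℝ, EP) φ.symm z)

/-- In finite dimension it suffices to evaluate on a fixed vector `w`; the result is the smooth
function `θ` on the tangent bundle of `P`, composed with the tangent map of `φ.symm` and the
constant field `w`. -/
theorem Connection.contDiffOn_localForm [FiniteDimensional ℝ E] (θ : Connection EG EP G P)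
    {φ : OpenPartialHomeomorph P E}
    (hφs : ContMDiffOn 𝓘(ℝ, E) 𝓘(ℝ, EP) ∞ φ.symm φ.target) :
    ContDiffOn ℝ ∞ (θ.localForm φ) φ.target := by
  rw [contDiffOn_clm_apply]
  intro w
  rw [← contMDiffOn_iff_contDiffOn]
  have h1 : ContMDiffOn 𝓘(ℝ, E) 𝓘(ℝ, E).tangent ∞
      (fun z => (⟨z, w⟩ : TangentBundle 𝓘(ℝ, E) E)) φ.target :=
    contMDiffOn_vectorSpace_iff_contDiffOn.2 contDiffOn_const
  have h2 := hφs.contMDiffOn_tangentMapWithin (m := ∞) (by simp)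
    φ.open_target.uniqueMDiffOn
  have h3 := θ.smooth.comp_contMDiffOn (h2.comp h1 fun z hz => hz)
  refine h3.congr fun z hz => ?_
  simp only [Function.comp, tangentMapWithin, mfderivWithin_of_isOpen φ.open_target hz]
  rfl

/-- Flatness of a connection in coordinates: the bracket of two local horizontal fields is
horizontal. -/
theorem Connection.localForm_lieBracket_eq_zero [CompleteSpace E] [CompleteSpace EP]
    {θ : Connection EG EP G P} (hflat : θ.IsFlat)
    {φ : OpenPartialHomeomorph P E}
    (hφ : ContMDiffOn 𝓘(ℝ, EP) 𝓘(ℝ, E) ∞ φ φ.source)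
    (hφs : ContMDiffOn 𝓘(ℝ, E) 𝓘(ℝ, EP) ∞ φ.symm φ.target) {V W : E → E}
    (hV : ContDiffOn ℝ ∞ V φ.target) (hW : ContDiffOn ℝ ∞ W φ.target)
    (hV0 : ∀ z ∈ φ.target, θ.localForm φ z (V z) = 0)
    (hW0 : ∀ z ∈ φ.target, θ.localForm φ z (W z) = 0) {z : E} (hz : z ∈ φ.target) :
    θ.localForm φ z (lieBracket ℝ V W z) = 0 := by
  have hinv : ∀ p ∈ φ.source, (mfderiv 𝓘(ℝ, EP) 𝓘(ℝ, E) φ p).inverse =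
      mfderiv 𝓘(ℝ, E) 𝓘(ℝ, EP) φ.symm (φ p) := fun p hp =>
    ContinuousLinearMap.inverse_eq (mfderiv_comp_mfderiv_symm hφ hφs hp).1
      (mfderiv_comp_mfderiv_symm hφ hφs hp).2
  have hpull : ∀ (V : ∀ x : E, TangentSpace 𝓘(ℝ, E) x), ∀ p ∈ φ.source,
      θ.form p (mpullback 𝓘(ℝ, EP) 𝓘(ℝ, E) φ V p) =
        θ.localForm φ (φ p) (V (φ p)) := by
    intro V p hp
    change θ.form p ((mfderiv 𝓘(ℝ, EP) 𝓘(ℝ, E) φ p).inverse (V (φ p))) = _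
    rw [hinv p hp]
    -- All tangent spaces of `P` are definitionally `EP`, so the vector is kept while the base point
    -- is rewritten.
    have : ∀ q (_ : q = p) (v : EP), θ.form p v = θ.form q v := by rintro q rfl v; rfl
    exact this _ (φ.left_inv hp) _
  have hsm : ∀ V : ∀ x : E, TangentSpace 𝓘(ℝ, E) x, ContDiffOn ℝ ∞ (V : E → E) φ.target →
      SmoothFieldOn (mpullback 𝓘(ℝ, EP) 𝓘(ℝ, E) φ V)
        φ.source := by
    intro V hV p hp
    refine (ContMDiffAt.mpullback_vectorField_preimage (n := ∞) ?_
      (hφ.contMDiffAt (φ.open_source.mem_nhds hp)) ?_ (by simp)).contMDiffWithinAt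
    · exact contMDiffAt_vectorSpace_iff_contDiffAt.2
        (hV.contDiffAt (φ.open_target.mem_nhds (φ.map_source hp)))
    · exact ContinuousLinearMap.IsInvertible.of_inverse (mfderiv_comp_mfderiv_symm hφ hφs hp).1
        (mfderiv_comp_mfderiv_symm hφ hφs hp).2
  have hp : φ.symm z ∈ φ.source := φ.map_target hz
  have hbr := Connection.form_mlieBracket_eq_zero hflat φ.open_source (hsm V hV) (hsm W hW)
    (fun p hp => by rw [hpull V p hp]; exact hV0 _ (φ.map_source hp))
    (fun p hp => by rw [hpull W p hp]; exact hW0 _ (φ.map_source hp)) hp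
  have : IsManifold 𝓘(ℝ, EP) (minSmoothness ℝ 2) P := by
    rw [minSmoothness_of_isRCLikeNormedField]; infer_instance
  have hVW : ∀ V : ∀ x : E, TangentSpace 𝓘(ℝ, E) x, ContDiffOn ℝ ∞ (V : E → E) φ.target → MDifferentiableAt 𝓘(ℝ, E) 𝓘(ℝ, E).tangent
      (fun x => (⟨x, V x⟩ : TangentBundle 𝓘(ℝ, E) E)) (φ (φ.symm z)) := fun V hV =>
    (contMDiffAt_vectorSpace_iff_contDiffAt.2
      (hV.contDiffAt (φ.open_target.mem_nhds (φ.map_source hp)))).mdifferentiableAt (by simp)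
  -- Pullback by `φ` commutes with brackets, which carries the vanishing from the bundle to the
  -- coordinates.
  have hcomm := mpullback_mlieBracket (n := ∞) (hVW V hV) (hVW W hW)
    (hφ.contMDiffAt (φ.open_source.mem_nhds hp))
    (by rw [minSmoothness_of_isRCLikeNormedField]; exact ENat.LEInfty.out)
  have hlie : mlieBracket 𝓘(ℝ, E) (V : ∀ x : E, TangentSpace 𝓘(ℝ, E) x) W =
      lieBracket ℝ V W :=
    mlieBracketWithin_univ.symm.trans
      (mlieBracketWithin_eq_lieBracketWithin.trans lieBracketWithin_univ)
  have h1 := (congrArg (θ.form (φ.symm z)) hcomm).trans hbr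
  have h2 := (hpull _ _ hp).symm.trans h1
  have h3 : ∀ z', z' = z →
      θ.localForm φ z' (mlieBracket 𝓘(ℝ, E) (V : ∀ x : E, TangentSpace 𝓘(ℝ, E) x) W z') = 0 →
      θ.localForm φ z (lieBracket ℝ V W z) = 0 := by
    rintro _ rfl h
    exact (congrArg (θ.localForm φ _) (congrFun hlie _)).symm.trans h
  exact h3 _ (φ.right_inv hz) h2

/-- The Frobenius theorem for a flat connection in coordinates: through every point there is a
horizontal graph over the base. -/
theorem Connection.exists_horizontal_graph {E₁ : Type*} [NormedAddCommGroup E₁] [NormedSpace ℝ E₁]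
    [FiniteDimensional ℝ E₁] [FiniteDimensional ℝ EG] [FiniteDimensional ℝ EP]
    {θ : Connection EG EP G P} (hflat : θ.IsFlat) {φ : OpenPartialHomeomorph P (E₁ × EG)}
    (hφ : ContMDiffOn 𝓘(ℝ, EP) 𝓘(ℝ, E₁ × EG) ∞ φ φ.source)
    (hφs : ContMDiffOn 𝓘(ℝ, E₁ × EG) 𝓘(ℝ, EP) ∞ φ.symm φ.target)
    (hvert : ∀ z ∈ φ.target, ∀ w : EG, θ.localForm φ z (0, w) = 0 → w = 0)
    {x₀ : E₁} {y₀ : EG} (h₀ : (x₀, y₀) ∈ φ.target) :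
    ∃ (f : E₁ → EG) (U : Set E₁), IsOpen U ∧ x₀ ∈ U ∧ f x₀ = y₀ ∧ ContDiffOn ℝ 1 f U ∧
      ∀ x ∈ U, (x, f x) ∈ φ.target ∧ ∃ f' : E₁ →L[ℝ] EG, HasFDerivAt f f' x ∧
        ∀ u, θ.localForm φ (x, f x) (u, f' u) = 0 := by
  have : CompleteSpace EG := FiniteDimensional.complete ℝ EG
  have : CompleteSpace E₁ := FiniteDimensional.complete ℝ E₁
  have : CompleteSpace EP := FiniteDimensional.complete ℝ EP
  set α := θ.localForm φ with hα
  have hαs : ContDiffOn ℝ ∞ α φ.target := θ.contDiffOn_localForm hφs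
  set A : E₁ × EG → EG →L[ℝ] EG := fun z => (α z).comp (ContinuousLinearMap.inr ℝ E₁ EG) with hA
  have hAs : ContDiffOn ℝ ∞ A φ.target := hαs.clm_comp contDiffOn_const
  have hAinv : ∀ z ∈ φ.target, (A z).IsInvertible := by
    intro z hz
    have hinj : Function.Injective (A z : EG →ₗ[ℝ] EG) := by
      rw [injective_iff_map_eq_zero]
      intro w hw
      exact hvert z hz w hw
    refine ⟨(LinearEquiv.ofInjectiveEndo _ hinj).toContinuousLinearEquiv, ?_⟩
    ext w
    rfl
  -- The slope of the horizontal space: `α (u, w) = 0` solved for the vertical component `w`.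
  set F : E₁ × EG → E₁ →L[ℝ] EG := fun z =>
    -((A z).inverse.comp ((α z).comp (ContinuousLinearMap.inl ℝ E₁ EG))) with hF
  have hFs : ContDiffOn ℝ ∞ F φ.target := by
    refine ContDiffOn.neg (ContDiffOn.clm_comp ?_ (hαs.clm_comp contDiffOn_const))
    intro z hz
    exact ((hAinv z hz).contDiffAt_map_inverse).comp_contDiffWithinAt z (hAs z hz)
  have hαF : ∀ z ∈ φ.target, ∀ u, α z (u, F z u) = 0 := by
    intro z hz u
    have h1 : ((u, F z u) : E₁ × EG) = (u, 0) + (0, F z u) := by simp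
    have h2 : α z (0, F z u) = A z (F z u) := rfl
    rw [h1, map_add, h2]
    simp only [hF, neg_apply, map_neg, ContinuousLinearMap.comp_apply,
      (hAinv z hz).self_apply_inverse, ContinuousLinearMap.inl_apply]
    abel
  have hlift : ∀ u, ContDiffOn ℝ ∞ (fun z => (u, F z u)) φ.target := fun u =>
    contDiffOn_const.prodMk (hFs.clm_apply contDiffOn_const)
  have hder : ∀ z ∈ φ.target, ∀ u w, fderiv ℝ (fun z => (u, F z u)) z w =
      (0, fderiv ℝ F z w u) := by
    intro z hz u w
    have h1 : HasFDerivAt F (fderiv ℝ F z) z :=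
      ((hFs.contDiffAt (φ.open_target.mem_nhds hz)).differentiableAt (by simp)).hasFDerivAt
    have h2 := (hasFDerivAt_const u z).prodMk (h1.clm_apply (hasFDerivAt_const u z))
    rw [h2.fderiv]
    simp
  have hint : ∀ z ∈ φ.target, ∀ u v, fderiv ℝ F z (u, F z u) v = fderiv ℝ F z (v, F z v) u := by
    intro z hz u v
    -- The bracket of the horizontal lifts of the constant fields `u` and `v` has no base component,
    -- and its vertical component is the defect of integrability. Being horizontal as well, it
    -- vanishes.
    have h := Connection.localForm_lieBracket_eq_zero hflat hφ hφs (hlift u) (hlift v)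
      (fun z hz => hαF z hz u) (fun z hz => hαF z hz v) hz
    rw [VectorField.lieBracket_eq] at h
    simp only [hder z hz, Prod.mk_sub_mk, sub_zero] at h
    exact sub_eq_zero.1 (hvert z hz _ h)
  obtain ⟨f, U, hU, hxU, hf0, hf⟩ := exists_hasFDerivAt_eq_of_integrable φ.open_target
    (hFs.of_le ENat.LEInfty.out) hint h₀
  refine ⟨f, U, hU, hxU, hf0, ?_, fun x hx => ⟨(hf x hx).1, _, (hf x hx).2, hαF _ (hf x hx).1⟩⟩
  -- The solution is `C^1` because its derivative `F (x, f x)` is continuous in `x`.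
  rw [show (1 : WithTop ℕ∞) = 0 + 1 from (zero_add 1).symm,
    contDiffOn_succ_iff_fderiv_of_isOpen hU, contDiffOn_zero]
  have hfd : DifferentiableOn ℝ f U :=
    fun x hx => (hf x hx).2.differentiableAt.differentiableWithinAt
  refine ⟨hfd, by simp, ContinuousOn.congr ?_ fun x hx => (hf x hx).2.fderiv⟩
  exact hFs.continuousOn.comp (continuousOn_id.prodMk hfd.continuousOn) fun x hx => (hf x hx).1

end Integrability

/-! ### Flat local sections of the principal bundle -/

section Sections

variable {EM EG EP : Type*}
  [NormedAddCommGroup EM] [NormedSpace ℝ EM]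
  [NormedAddCommGroup EG] [NormedSpace ℝ EG]
  [NormedAddCommGroup EP] [NormedSpace ℝ EP]
  {M G P : Type*}
  [TopologicalSpace M] [ChartedSpace EM M]
  [TopologicalSpace G] [ChartedSpace EG G] [Group G]
  [TopologicalSpace P] [ChartedSpace EP P] [MulAction Gᵐᵒᵖ P]

theorem op_smul_op_smul {G P : Type*} [Group G] [MulAction Gᵐᵒᵖ P] (g h : G) (p : P) :
    MulOpposite.op h • MulOpposite.op g • p = MulOpposite.op (g * h) • p := by
  rw [smul_smul, ← MulOpposite.op_mul]

theorem contMDiff_op_smul_left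
    (hact : ContMDiff (𝓘(ℝ, EP).prod 𝓘(ℝ, EG)) 𝓘(ℝ, EP) ∞
      (fun q : P × G => MulOpposite.op q.2 • q.1)) (g : G) :
    ContMDiff 𝓘(ℝ, EP) 𝓘(ℝ, EP) ∞ (fun q : P => MulOpposite.op g • q) :=
  hact.comp (contMDiff_id.prodMk contMDiff_const)

theorem contMDiff_op_smul_right
    (hact : ContMDiff (𝓘(ℝ, EP).prod 𝓘(ℝ, EG)) 𝓘(ℝ, EP) ∞
      (fun q : P × G => MulOpposite.op q.2 • q.1)) (p : P) :
    ContMDiff 𝓘(ℝ, EG) 𝓘(ℝ, EP) ∞ (fun g : G => MulOpposite.op g • p) :=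
  hact.comp (contMDiff_const.prodMk contMDiff_id)

variable [IsManifold 𝓘(ℝ, EP) ∞ P] [LieGroup 𝓘(ℝ, EG) ∞ G]

/-- The connection form on a vertical vector is its Maurer-Cartan form. -/
theorem Connection.form_mfderiv_op_smul (θ : Connection EG EP G P)
    (hact : ContMDiff (𝓘(ℝ, EP).prod 𝓘(ℝ, EG)) 𝓘(ℝ, EP) ∞
      (fun q : P × G => MulOpposite.op q.2 • q.1)) (p : P) (g : G) (w : TangentSpace 𝓘(ℝ, EG) g) :
    θ.form (MulOpposite.op g • p)
      (mfderiv 𝓘(ℝ, EG) 𝓘(ℝ, EP) (fun h : G => MulOpposite.op h • p) g w) =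
      mfderiv 𝓘(ℝ, EG) 𝓘(ℝ, EG) (fun h : G => g⁻¹ * h) g w := by
  -- Since `p · h = (p · g) · (g⁻¹ h)`, the derivative of the orbit map at `g` is a fundamental
  -- vector at `p · g`.
  have h1 : HasMFDerivAt 𝓘(ℝ, EG) 𝓘(ℝ, EP)
      (fun k : G => MulOpposite.op k • MulOpposite.op g • p) (g⁻¹ * g)
      (mfderiv 𝓘(ℝ, EG) 𝓘(ℝ, EP) (fun k : G => MulOpposite.op k • MulOpposite.op g • p) 1) := by
    rw [inv_mul_cancel]
    exact ((contMDiff_op_smul_right hact _ 1).mdifferentiableAt (by simp)).hasMFDerivAt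
  have h2 : HasMFDerivAt 𝓘(ℝ, EG) 𝓘(ℝ, EG) (fun h : G => g⁻¹ * h) g
      (mfderiv 𝓘(ℝ, EG) 𝓘(ℝ, EG) (fun h : G => g⁻¹ * h) g) :=
    (((contMDiff_mul_left (I := 𝓘(ℝ, EG)) (n := ∞) (a := g⁻¹)) g).mdifferentiableAt
      (by simp)).hasMFDerivAt
  have h3 := h1.comp g h2
  have h4 : (fun k : G => MulOpposite.op k • MulOpposite.op g • p) ∘ (fun h : G => g⁻¹ * h) =
      fun h : G => MulOpposite.op h • p := by
    funext h
    simp only [Function.comp, op_smul_op_smul, mul_inv_cancel_left]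
  rw [h4] at h3
  have h5 := θ.form_fundamentalField (MulOpposite.op g • p)
    (mfderiv 𝓘(ℝ, EG) 𝓘(ℝ, EG) (fun h : G => g⁻¹ * h) g w : EG)
  refine Eq.trans ?_ h5
  exact congrArg (θ.form (MulOpposite.op g • p)) (DFunLike.congr_fun h3.mfderiv w)

/-- If a curve (or a map from any manifold) `b` in the bundle and its gauge transform `b · g` are
both horizontal in the direction `v`, then `g` is stationary in the direction `v`. -/
theorem Connection.mfderiv_eq_zero_of_horizontal (θ : Connection EG EP G P)
    (hact : ContMDiff (𝓘(ℝ, EP).prod 𝓘(ℝ, EG)) 𝓘(ℝ, EP) ∞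
      (fun q : P × G => MulOpposite.op q.2 • q.1))
    {EN N : Type*} [NormedAddCommGroup EN] [NormedSpace ℝ EN] [TopologicalSpace N]
    [ChartedSpace EN N] {a b : N → P} {g : N → G} {n : N} (v : TangentSpace 𝓘(ℝ, EN) n)
    (hb : MDifferentiableAt 𝓘(ℝ, EN) 𝓘(ℝ, EP) b n)
    (hg : MDifferentiableAt 𝓘(ℝ, EN) 𝓘(ℝ, EG) g n)
    (hab : a =ᶠ[nhds n] fun m => MulOpposite.op (g m) • b m)
    (hb0 : θ.form (b n) (mfderiv 𝓘(ℝ, EN) 𝓘(ℝ, EP) b n v) = 0)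
    (ha0 : θ.form (a n) (mfderiv 𝓘(ℝ, EN) 𝓘(ℝ, EP) a n v) = 0) :
    mfderiv 𝓘(ℝ, EN) 𝓘(ℝ, EG) g n v = 0 := by
  set w := mfderiv 𝓘(ℝ, EN) 𝓘(ℝ, EG) g n v with hw
  set u := mfderiv 𝓘(ℝ, EN) 𝓘(ℝ, EP) b n v with hu
  have hm : MDifferentiableAt (𝓘(ℝ, EP).prod 𝓘(ℝ, EG)) 𝓘(ℝ, EP)
      (fun q : P × G => MulOpposite.op q.2 • q.1) (b n, g n) :=
    (hact _).mdifferentiableAt (by simp)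
  have h1 := hm.hasMFDerivAt.comp n (hb.hasMFDerivAt.prodMk hg.hasMFDerivAt)
  have h2 := h1.congr_of_eventuallyEq hab
  -- Leibniz rule for `b · g`. Applying `θ` gives `Ad (g⁻¹) θ (b') + g⁻¹ g'`, in which only `g⁻¹ g'`
  -- remains.
  have h3 : mfderiv 𝓘(ℝ, EN) 𝓘(ℝ, EP) a n v =
      mfderiv 𝓘(ℝ, EP) 𝓘(ℝ, EP) (fun q : P => MulOpposite.op (g n) • q) (b n) u +
      mfderiv 𝓘(ℝ, EG) 𝓘(ℝ, EP) (fun h : G => MulOpposite.op h • b n) (g n) w :=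
    (DFunLike.congr_fun h2.mfderiv v).trans (mfderiv_prod_eq_add_apply hm)
  have h4 : θ.form (MulOpposite.op (g n) • b n)
      (mfderiv 𝓘(ℝ, EP) 𝓘(ℝ, EP) (fun q : P => MulOpposite.op (g n) • q) (b n) u +
      mfderiv 𝓘(ℝ, EG) 𝓘(ℝ, EP) (fun h : G => MulOpposite.op h • b n) (g n) w) = 0 := by
    have : ∀ q (_ : q = a n) (v' : EP), θ.form (a n) v' = 0 → θ.form q v' = 0 := by
      rintro q rfl v' h; exact h
    exact this _ hab.self_of_nhds.symm _ ((congrArg (θ.form (a n)) h3).symm.trans ha0)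
  rw [map_add, θ.form_act, hb0, θ.form_mfderiv_op_smul hact] at h4
  have h5 : Ad EG (g n)⁻¹ (0 : GroupLieAlgebra 𝓘(ℝ, EG) G) = 0 := map_zero _
  rw [h5] at h4
  have h4 : (mfderiv 𝓘(ℝ, EG) 𝓘(ℝ, EG) (fun h : G => (g n)⁻¹ * h) (g n) w : EG) = 0 :=
    (zero_add _).symm.trans h4
  have hL : ∀ (h k : G), HasMFDerivAt 𝓘(ℝ, EG) 𝓘(ℝ, EG) (fun h' : G => h * h') k
      (mfderiv 𝓘(ℝ, EG) 𝓘(ℝ, EG) (fun h' : G => h * h') k) := fun h k =>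
    (((contMDiff_mul_left (I := 𝓘(ℝ, EG)) (n := ∞) (a := h)) k).mdifferentiableAt
      (by simp)).hasMFDerivAt
  have h6 := (hL (g n) ((g n)⁻¹ * g n)).comp (g n) (hL (g n)⁻¹ (g n))
  have h7 : (fun h' : G => g n * h') ∘ (fun h' : G => (g n)⁻¹ * h') = id := by
    funext h; simp
  rw [h7] at h6
  have h8 := DFunLike.congr_fun (hasMFDerivAt_unique h6 (hasMFDerivAt_id (g n))) w
  have h9 : (mfderiv 𝓘(ℝ, EG) 𝓘(ℝ, EG) (fun h' : G => g n * h') ((g n)⁻¹ * g n))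
      (mfderiv 𝓘(ℝ, EG) 𝓘(ℝ, EG) (fun h' : G => (g n)⁻¹ * h') (g n) w) = w := h8
  rw [← h9]
  exact (congrArg _ h4).trans (map_zero _)

variable (EM) in
/-- A flat local section of the bundle `proj`, defined on the open set `U`. -/
structure Connection.IsFlatSection (θ : Connection EG EP G P) (proj : P → M) (s : M → P)
    (U : Set M) : Prop where
  isOpen : IsOpen U
  proj_eq : ∀ x ∈ U, proj (s x) = x
  contMDiffOn : ContMDiffOn 𝓘(ℝ, EM) 𝓘(ℝ, EP) 1 s U
  horizontal : ∀ x ∈ U, ∀ v : TangentSpace 𝓘(ℝ, EM) x,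
    θ.form (s x) (mfderiv 𝓘(ℝ, EM) 𝓘(ℝ, EP) s x v) = 0

-- The equivariance of `θ` makes horizontality invariant under right translation, so each flat
-- section yields a whole family of leaves over `U`.
omit [LieGroup 𝓘(ℝ, EG) ∞ G] in
theorem Connection.IsFlatSection.op_smul {θ : Connection EG EP G P} {proj : P → M}
    (hproj : IsPrincipalBundle EM EG EP (G := G) proj) {s : M → P} {U : Set M}
    (hs : θ.IsFlatSection EM proj s U) (g : G) :
    θ.IsFlatSection EM proj (fun x => MulOpposite.op g • s x) U where
  isOpen := hs.isOpen
  proj_eq x hx := by rw [hproj.proj_act, hs.proj_eq x hx]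
  contMDiffOn := ((contMDiff_op_smul_left hproj.contMDiff_act g).of_le
    ENat.LEInfty.out).comp_contMDiffOn hs.contMDiffOn
  horizontal x hx v := by
    have h1 := (contMDiff_op_smul_left hproj.contMDiff_act g (s x)).mdifferentiableAt (by simp)
    have h2 := (hs.contMDiffOn.contMDiffAt (hs.isOpen.mem_nhds hx)).mdifferentiableAt (by simp)
    have h3 := (h1.hasMFDerivAt.comp x h2.hasMFDerivAt).mfderiv
    have h4 := θ.form_act g (s x) (mfderiv 𝓘(ℝ, EM) 𝓘(ℝ, EP) s x v)
    rw [hs.horizontal x hx v] at h4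
    have h5 : Ad EG g⁻¹ (0 : GroupLieAlgebra 𝓘(ℝ, EG) G) = 0 := map_zero _
    exact (congrArg (θ.form _) (DFunLike.congr_fun h3 v)).trans (h4.trans h5)

variable [IsManifold 𝓘(ℝ, EM) ∞ M]

/-- The coordinates of the total space given by a trivialization and charts of the base and of
the group. -/
noncomputable def bundleChart {proj : P → M} (e : Bundle.Trivialization G proj) (x₀ : M) (g₀ : G) :
    OpenPartialHomeomorph P (EM × EG) :=
  e.toOpenPartialHomeomorph.trans ((chartAt EM x₀).prod (chartAt EG g₀))

omit [MulAction Gᵐᵒᵖ P] [IsManifold 𝓘(ℝ, EP) ∞ P] in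
theorem contMDiffOn_bundleChart {proj : P → M} {e : Bundle.Trivialization G proj}
    (he : ContMDiffOn 𝓘(ℝ, EP) (𝓘(ℝ, EM).prod 𝓘(ℝ, EG)) ∞ e e.source) (x₀ : M) (g₀ : G) :
    ContMDiffOn 𝓘(ℝ, EP) 𝓘(ℝ, EM × EG) ∞ (bundleChart e x₀ g₀ : P → EM × EG)
      (bundleChart (EM := EM) (EG := EG) e x₀ g₀).source := by
  have hsub : (bundleChart (EM := EM) (EG := EG) e x₀ g₀).source ⊆ e.source := fun p hp => by
    simp only [bundleChart, OpenPartialHomeomorph.trans_source] at hp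
    exact hp.1
  have hmem : ∀ p ∈ (bundleChart (EM := EM) (EG := EG) e x₀ g₀).source,
      (e p).1 ∈ (chartAt EM x₀).source ∧ (e p).2 ∈ (chartAt EG g₀).source := fun p hp => by
    simp only [bundleChart, OpenPartialHomeomorph.trans_source] at hp
    exact hp.2
  have h1 : ContMDiffOn 𝓘(ℝ, EP) 𝓘(ℝ, EM) ∞ (fun p => chartAt EM x₀ (e p).1)
      (bundleChart (EM := EM) (EG := EG) e x₀ g₀).source :=
    (contMDiffOn_chart (I := 𝓘(ℝ, EM)) (n := ∞)).comp
      (contMDiff_fst.comp_contMDiffOn (he.mono hsub)) fun p hp => (hmem p hp).1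
  have h2 : ContMDiffOn 𝓘(ℝ, EP) 𝓘(ℝ, EG) ∞ (fun p => chartAt EG g₀ (e p).2)
      (bundleChart (EM := EM) (EG := EG) e x₀ g₀).source :=
    (contMDiffOn_chart (I := 𝓘(ℝ, EG)) (n := ∞)).comp
      (contMDiff_snd.comp_contMDiffOn (he.mono hsub)) fun p hp => (hmem p hp).2
  exact h1.prodMk_space h2

omit [NormedSpace ℝ EM] [NormedSpace ℝ EG] [Group G] [MulAction Gᵐᵒᵖ P]
  [LieGroup 𝓘(ℝ, EG) ∞ G] [IsManifold 𝓘(ℝ, EM) ∞ M] in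
theorem mem_bundleChart_target {proj : P → M} {e : Bundle.Trivialization G proj} {x₀ : M} {g₀ : G}
    {z : EM × EG} : z ∈ (bundleChart (EM := EM) (EG := EG) e x₀ g₀).target ↔
      z.1 ∈ (chartAt EM x₀).target ∧ z.2 ∈ (chartAt EG g₀).target ∧
        (chartAt EM x₀).symm z.1 ∈ e.baseSet := by
  simp only [bundleChart, OpenPartialHomeomorph.trans_target, OpenPartialHomeomorph.prod_target,
    mem_inter_iff, mem_prod, mem_preimage, Bundle.Trivialization.target_eq]
  simp [and_assoc]

omit [NormedSpace ℝ EM] [NormedSpace ℝ EG] [Group G] [MulAction Gᵐᵒᵖ P]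
  [LieGroup 𝓘(ℝ, EG) ∞ G] [IsManifold 𝓘(ℝ, EM) ∞ M] in
theorem bundleChart_symm_apply {proj : P → M} (e : Bundle.Trivialization G proj) (x₀ : M) (g₀ : G)
    (z : EM × EG) : (bundleChart (EM := EM) (EG := EG) e x₀ g₀).symm z =
      e.toOpenPartialHomeomorph.symm ((chartAt EM x₀).symm z.1, (chartAt EG g₀).symm z.2) := rfl

omit [MulAction Gᵐᵒᵖ P] [IsManifold 𝓘(ℝ, EP) ∞ P] in
theorem contMDiffOn_bundleChart_symm {proj : P → M} {e : Bundle.Trivialization G proj}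
    (he : ContMDiffOn (𝓘(ℝ, EM).prod 𝓘(ℝ, EG)) 𝓘(ℝ, EP) ∞ e.toOpenPartialHomeomorph.symm e.target)
    (x₀ : M) (g₀ : G) :
    ContMDiffOn 𝓘(ℝ, EM × EG) 𝓘(ℝ, EP) ∞ (bundleChart (EM := EM) (EG := EG) e x₀ g₀).symm
      (bundleChart (EM := EM) (EG := EG) e x₀ g₀).target := by
  have h1 : ContMDiffOn 𝓘(ℝ, EM × EG) 𝓘(ℝ, EM) ∞ (fun z : EM × EG => (chartAt EM x₀).symm z.1)
      (bundleChart (EM := EM) (EG := EG) e x₀ g₀).target :=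
    (contMDiffOn_chart_symm (I := 𝓘(ℝ, EM)) (n := ∞)).comp
      contDiff_fst.contMDiff.contMDiffOn fun p hp => (mem_bundleChart_target.1 hp).1
  have h2 : ContMDiffOn 𝓘(ℝ, EM × EG) 𝓘(ℝ, EG) ∞ (fun z : EM × EG => (chartAt EG g₀).symm z.2)
      (bundleChart (EM := EM) (EG := EG) e x₀ g₀).target :=
    (contMDiffOn_chart_symm (I := 𝓘(ℝ, EG)) (n := ∞)).comp
      contDiff_snd.contMDiff.contMDiffOn fun p hp => (mem_bundleChart_target.1 hp).2.1
  exact he.comp (h1.prodMk h2) fun z hz =>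
    e.mem_target.2 (mem_bundleChart_target.1 hz).2.2

/-- In bundle coordinates, a connection form is nondegenerate on vertical vectors. -/
theorem Connection.eq_zero_of_localForm_bundleChart (θ : Connection EG EP G P) {proj : P → M}
    (hproj : IsPrincipalBundle EM EG EP (G := G) proj) {e : Bundle.Trivialization G proj}
    (he : ContMDiffOn (𝓘(ℝ, EM).prod 𝓘(ℝ, EG)) 𝓘(ℝ, EP) ∞ e.toOpenPartialHomeomorph.symm e.target)
    (heq : ∀ p ∈ e.source, ∀ g : G, e (MulOpposite.op g • p) = ((e p).1, (e p).2 * g))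
    {x₀ : M} {g₀ : G} {z : EM × EG} (hz : z ∈ (bundleChart (EM := EM) (EG := EG) e x₀ g₀).target)
    {w : EG} (hw : θ.localForm (bundleChart (EM := EM) (EG := EG) e x₀ g₀) z (0, w) = 0) :
    w = 0 := by
  set φ := bundleChart (EM := EM) (EG := EG) e x₀ g₀ with hφ
  obtain ⟨hz1, hz2, hz3⟩ := mem_bundleChart_target.1 hz
  set q : P := e.toOpenPartialHomeomorph.symm ((chartAt EM x₀).symm z.1, 1) with hq
  have htgt : ∀ h : G, ((chartAt EM x₀).symm z.1, h) ∈ e.target := fun h => by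
    rw [e.target_eq]; exact ⟨hz3, mem_univ _⟩
  have hqs : q ∈ e.source := e.toOpenPartialHomeomorph.map_target (htgt 1)
  have heq' : e q = ((chartAt EM x₀).symm z.1, 1) :=
    e.toOpenPartialHomeomorph.right_inv (htgt 1)
  -- In these coordinates the vertical slice through `z` is an orbit map read in a chart of `G`.
  have hfib : ∀ y, φ.symm (z.1, y) = MulOpposite.op ((chartAt EG g₀).symm y) • q := by
    intro y
    rw [hφ, bundleChart_symm_apply]
    have h1 : e.toOpenPartialHomeomorph (MulOpposite.op ((chartAt EG g₀).symm y) • q) =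
        ((chartAt EM x₀).symm z.1, (chartAt EG g₀).symm y) := by
      have := heq q hqs ((chartAt EG g₀).symm y)
      rw [heq', one_mul] at this
      exact this
    rw [← h1]
    refine e.toOpenPartialHomeomorph.left_inv ?_
    have hs : e.toOpenPartialHomeomorph.source = proj ⁻¹' e.baseSet := e.source_eq
    have hqs' : proj q ∈ e.baseSet := by rw [← mem_preimage, ← e.source_eq]; exact hqs
    rw [hs, mem_preimage, hproj.proj_act]
    exact hqs'
  have hcs : MDifferentiableAt 𝓘(ℝ, EG) 𝓘(ℝ, EG) (chartAt EG g₀).symm z.2 :=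
    ((contMDiffOn_chart_symm (I := 𝓘(ℝ, EG)) (n := ∞)).contMDiffAt
      ((chartAt EG g₀).open_target.mem_nhds hz2)).mdifferentiableAt (by simp)
  have hφd : HasMFDerivAt 𝓘(ℝ, EM × EG) 𝓘(ℝ, EP) φ.symm z
      (mfderiv 𝓘(ℝ, EM × EG) 𝓘(ℝ, EP) φ.symm z) :=
    (((contMDiffOn_bundleChart_symm he x₀ g₀).contMDiffAt
      (φ.open_target.mem_nhds hz)).mdifferentiableAt (by simp)).hasMFDerivAt
  have hpair : HasMFDerivAt 𝓘(ℝ, EG) 𝓘(ℝ, EM × EG) (fun y : EG => (z.1, y)) z.2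
      (ContinuousLinearMap.inr ℝ EM EG) :=
    (hasFDerivAt_prodMk_right z.1 z.2).hasMFDerivAt
  have hcomp : HasMFDerivAt 𝓘(ℝ, EG) 𝓘(ℝ, EP) (fun y : EG => φ.symm (z.1, y)) z.2
      ((mfderiv 𝓘(ℝ, EM × EG) 𝓘(ℝ, EP) φ.symm z).comp (ContinuousLinearMap.inr ℝ EM EG)) :=
    hφd.comp z.2 hpair
  -- The slice is compared with the constant map `q`, which is trivially horizontal. If the slice is
  -- horizontal in the direction `w`, the inverse chart is stationary there, and it is an immersion.
  have h0 : mfderiv 𝓘(ℝ, EG) 𝓘(ℝ, EG) (chartAt EG g₀).symm z.2 w = 0 := by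
    refine θ.mfderiv_eq_zero_of_horizontal hproj.contMDiff_act
      (a := fun y : EG => φ.symm (z.1, y)) (b := fun _ => q) (n := z.2) w
      mdifferentiableAt_const hcs (Filter.Eventually.of_forall hfib) ?_ ?_
    · rw [mfderiv_const]
      exact map_zero _
    · exact (congrArg (θ.form (φ.symm z)) (DFunLike.congr_fun hcomp.mfderiv w)).trans hw
  have hid : HasMFDerivAt 𝓘(ℝ, EG) 𝓘(ℝ, EG) (chartAt EG g₀ ∘ (chartAt EG g₀).symm) z.2
      (ContinuousLinearMap.id ℝ _) :=
    (hasMFDerivAt_id z.2).congr_of_eventuallyEq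
      (Filter.eventuallyEq_of_mem ((chartAt EG g₀).open_target.mem_nhds hz2)
        fun z hz => (chartAt EG g₀).right_inv hz)
  have hc : HasMFDerivAt 𝓘(ℝ, EG) 𝓘(ℝ, EG) (chartAt EG g₀) ((chartAt EG g₀).symm z.2)
      (mfderiv 𝓘(ℝ, EG) 𝓘(ℝ, EG) (chartAt EG g₀) ((chartAt EG g₀).symm z.2)) :=
    (((contMDiffOn_chart (I := 𝓘(ℝ, EG)) (n := ∞)).contMDiffAt
      ((chartAt EG g₀).open_source.mem_nhds
        ((chartAt EG g₀).map_target hz2))).mdifferentiableAt (by simp)).hasMFDerivAt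
  have h2 := DFunLike.congr_fun (hasMFDerivAt_unique (hc.comp z.2 hcs.hasMFDerivAt) hid) w
  have h3 : (mfderiv 𝓘(ℝ, EG) 𝓘(ℝ, EG) (chartAt EG g₀) ((chartAt EG g₀).symm z.2)
      (mfderiv 𝓘(ℝ, EG) 𝓘(ℝ, EG) (chartAt EG g₀).symm z.2 w) : EG) = w := h2
  rw [← h3]
  exact (congrArg _ h0).trans (map_zero _)

/-- A flat connection has a flat local section through every point. -/
theorem Connection.exists_isFlatSection [FiniteDimensional ℝ EM] [FiniteDimensional ℝ EG]
    [FiniteDimensional ℝ EP] {θ : Connection EG EP G P} (hflat : θ.IsFlat) {proj : P → M}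
    (hproj : IsPrincipalBundle EM EG EP (G := G) proj) (p : P) :
    ∃ (s : M → P) (U : Set M), θ.IsFlatSection EM proj s U ∧ proj p ∈ U ∧ s (proj p) = p := by
  obtain ⟨e, hxe, he1, he2, he3⟩ := hproj.exists_trivialization (proj p)
  set x₀ := proj p with hx₀
  set g₀ := (e p).2 with hg₀
  set φ := bundleChart (EM := EM) (EG := EG) e x₀ g₀ with hφ
  have hpe : p ∈ e.source := by rw [e.source_eq]; exact hxe
  have hep : e p = (x₀, g₀) := Prod.ext (e.coe_fst hpe) rfl
  have hz0 : (chartAt EM x₀ x₀, chartAt EG g₀ g₀) ∈ φ.target := by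
    refine mem_bundleChart_target.2 ⟨mem_chart_target _ _, mem_chart_target _ _, ?_⟩
    rw [(chartAt EM x₀).left_inv (mem_chart_source _ _)]
    exact hxe
  obtain ⟨f, U, hU, hxU, hf0, hfC, hf⟩ := Connection.exists_horizontal_graph hflat
    (contMDiffOn_bundleChart he1 x₀ g₀) (contMDiffOn_bundleChart_symm he2 x₀ g₀)
    (fun z hz w hw => θ.eq_zero_of_localForm_bundleChart hproj he2 he3 hz hw) hz0
  have hproj_symm : ∀ z ∈ φ.target, proj (φ.symm z) = (chartAt EM x₀).symm z.1 := by
    intro z hz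
    rw [hφ, bundleChart_symm_apply]
    exact e.proj_symm_apply (by
      rw [e.target_eq]; exact ⟨(mem_bundleChart_target.1 hz).2.2, mem_univ _⟩)
  set V := (chartAt EM x₀).source ∩ chartAt EM x₀ ⁻¹' U with hV
  have hVo : IsOpen V := (chartAt EM x₀).isOpen_inter_preimage hU
  have hchart : ContMDiffOn 𝓘(ℝ, EM) 𝓘(ℝ, EM) ∞ (chartAt EM x₀) V :=
    (contMDiffOn_chart (I := 𝓘(ℝ, EM)) (n := ∞)).mono inter_subset_left
  have hgraph : ContMDiffOn 𝓘(ℝ, EM) 𝓘(ℝ, EM × EG) 1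
      (fun x => (chartAt EM x₀ x, f (chartAt EM x₀ x))) V :=
    (hchart.of_le ENat.LEInfty.out).prodMk_space
      (hfC.contMDiffOn.comp (hchart.of_le ENat.LEInfty.out) fun x hx => hx.2)
  refine ⟨fun x => φ.symm (chartAt EM x₀ x, f (chartAt EM x₀ x)), V, ⟨hVo, ?_, ?_, ?_⟩,
    ⟨mem_chart_source _ _, hxU⟩, ?_⟩
  · intro x hx
    rw [hproj_symm _ (hf _ hx.2).1]
    exact (chartAt EM x₀).left_inv hx.1
  · exact ((contMDiffOn_bundleChart_symm he2 x₀ g₀).of_le ENat.LEInfty.out).comp hgraph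
      fun x hx => (hf _ hx.2).1
  · intro x hx v
    obtain ⟨htar, f', hf', hf0⟩ := hf _ hx.2
    have h1 : HasMFDerivAt 𝓘(ℝ, EM) 𝓘(ℝ, EM) (chartAt EM x₀) x
        (mfderiv 𝓘(ℝ, EM) 𝓘(ℝ, EM) (chartAt EM x₀) x) :=
      ((hchart.contMDiffAt (hVo.mem_nhds hx)).mdifferentiableAt (by simp)).hasMFDerivAt
    have h2 : HasMFDerivAt 𝓘(ℝ, EM) 𝓘(ℝ, EM × EG) (fun u : EM => (u, f u)) (chartAt EM x₀ x)
        ((ContinuousLinearMap.id ℝ EM).prod f') :=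
      ((hasFDerivAt_id _).prodMk hf').hasMFDerivAt
    have h3 : HasMFDerivAt 𝓘(ℝ, EM × EG) 𝓘(ℝ, EP) φ.symm
        (chartAt EM x₀ x, f (chartAt EM x₀ x))
        (mfderiv 𝓘(ℝ, EM × EG) 𝓘(ℝ, EP) φ.symm (chartAt EM x₀ x, f (chartAt EM x₀ x))) :=
      (((contMDiffOn_bundleChart_symm he2 x₀ g₀).contMDiffAt
        (φ.open_target.mem_nhds htar)).mdifferentiableAt (by simp)).hasMFDerivAt
    have h4 := h3.comp x (h2.comp x h1)
    exact (congrArg (θ.form _) (DFunLike.congr_fun h4.mfderiv v)).trans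
      (hf0 (mfderiv 𝓘(ℝ, EM) 𝓘(ℝ, EM) (chartAt EM x₀) x v))
  · change φ.symm (chartAt EM x₀ x₀, f (chartAt EM x₀ x₀)) = p
    rw [hf0, hφ, bundleChart_symm_apply]
    simp only
    rw [(chartAt EM x₀).left_inv (mem_chart_source _ _),
      (chartAt EG g₀).left_inv (mem_chart_source _ _), ← hep]
    exact e.toOpenPartialHomeomorph.left_inv hpe

end Sections

/-! ### Constancy of maps with vanishing derivative -/

section Constancy

variable {E : Type*} [NormedAddCommGroup E] [NormedSpace ℝ E]
  {N : Type*} [TopologicalSpace N] [ChartedSpace E N] [IsManifold 𝓘(ℝ, E) ∞ N]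

/-- A continuous curve in a manifold whose velocity vanishes off a finite set is constant. -/
theorem eq_of_mfderiv_eq_zero_off_finite [CompleteSpace E] [T1Space N] {g : ℝ → N} {S : Set ℝ}
    (hS : S.Finite) (hg : ContinuousOn g (Icc 0 1))
    (hd : ∀ t ∈ Ioo (0 : ℝ) 1 \ S, MDifferentiableAt 𝓘(ℝ) 𝓘(ℝ, E) g t ∧
      mfderiv 𝓘(ℝ) 𝓘(ℝ, E) g t (1 : ℝ) = 0) :
    ∀ t ∈ Icc (0 : ℝ) 1, g t = g 0 := by
  have hcl : IsClosed ({t | g t = g 0} ∩ Icc (0 : ℝ) 1) := by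
    rw [inter_comm]
    exact hg.preimage_isClosed_of_isClosed isClosed_Icc isClosed_singleton
  refine hcl.Icc_subset_of_forall_exists_gt rfl fun x ⟨hx0, hx⟩ y hy => ?_
  set χ := chartAt E (g x) with hχ
  have hnhds : g ⁻¹' χ.source ∈ nhdsWithin x (Icc 0 1) :=
    hg x (Ico_subset_Icc_self hx) (χ.open_source.mem_nhds (mem_chart_source _ _))
  have hnhds' : g ⁻¹' χ.source ∈ nhdsWithin x (Ici x) := by
    refine nhdsWithin_le_iff.2 ?_ hnhds
    exact Filter.mem_of_superset (Icc_mem_nhdsGE hx.2) (Icc_subset_Icc_left hx.1)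
  obtain ⟨b, hb, hbsub⟩ := (mem_nhdsGE_iff_exists_Icc_subset).1 hnhds'
  -- Below `b` the curve stays in the chart, `y` is the bound imposed by the continuous induction,
  -- and `1` is the end of the interval.
  set b' := min b (min y 1) with hb'
  have hxb' : x < b' := lt_min hb (lt_min hy hx.2)
  have hb'1 : b' ≤ 1 := (min_le_right _ _).trans (min_le_right _ _)
  have hsub : Icc x b' ⊆ g ⁻¹' χ.source := (Icc_subset_Icc_right (min_le_left _ _)).trans hbsub
  have hcont : ContinuousOn (χ ∘ g) (Icc x b') :=
    χ.continuousOn.comp (hg.mono (Icc_subset_Icc hx.1 hb'1)) hsub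
  have hder : ∀ t ∈ Ioo x b' \ S, HasDerivAt (χ ∘ g) 0 t := by
    intro t ht
    obtain ⟨hgd, hg0⟩ := hd t ⟨⟨hx.1.trans_lt ht.1.1, ht.1.2.trans_le hb'1⟩, ht.2⟩
    have hc : MDifferentiableAt 𝓘(ℝ, E) 𝓘(ℝ, E) χ (g t) :=
      ((contMDiffOn_chart (I := 𝓘(ℝ, E)) (n := ∞)).contMDiffAt
        (χ.open_source.mem_nhds (hsub (Ioo_subset_Icc_self ht.1)))).mdifferentiableAt (by simp)
    let L : ℝ →L[ℝ] E :=
      (mfderiv 𝓘(ℝ, E) 𝓘(ℝ, E) χ (g t)).comp (mfderiv 𝓘(ℝ) 𝓘(ℝ, E) g t)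
    have h1 : HasFDerivAt (χ ∘ g) L t := (hc.hasMFDerivAt.comp t hgd.hasMFDerivAt).hasFDerivAt
    refine h1.hasDerivAt.congr_deriv ?_
    exact (congrArg (mfderiv 𝓘(ℝ, E) 𝓘(ℝ, E) χ (g t)) hg0).trans (map_zero _)
  have hint := MeasureTheory.integral_eq_of_hasDerivAt_off_countable_of_le (χ ∘ g) (fun _ => 0)
    hxb'.le hS.countable hcont hder (by simp)
  rw [intervalIntegral.integral_zero] at hint
  refine ⟨b', ?_, hxb', (min_le_right _ _).trans (min_le_left _ _)⟩
  have h2 : g b' = g x := χ.injOn (hsub (right_mem_Icc.2 hxb'.le)) (mem_chart_source _ _)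
    (sub_eq_zero.1 hint.symm)
  exact h2.trans hx0

/-- A map between manifolds with vanishing derivative is locally constant. -/
theorem eventually_eq_of_mfderiv_eq_zero {E' : Type*} [NormedAddCommGroup E'] [NormedSpace ℝ E']
    {M : Type*} [TopologicalSpace M] [ChartedSpace E' M] [IsManifold 𝓘(ℝ, E') ∞ M] {f : M → N}
    {x : M} {U : Set M} (hU : U ∈ nhds x) (hf : ∀ y ∈ U, MDifferentiableAt 𝓘(ℝ, E') 𝓘(ℝ, E) f y)
    (hd : ∀ y ∈ U, ∀ v : TangentSpace 𝓘(ℝ, E') y, mfderiv 𝓘(ℝ, E') 𝓘(ℝ, E) f y v = 0) :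
    ∀ᶠ y in nhds x, f y = f x := by
  set χ := chartAt E (f x) with hχ
  set ψ := chartAt E' x with hψ
  have hxU : x ∈ U := mem_of_mem_nhds hU
  have hV : U ∩ f ⁻¹' χ.source ∩ ψ.source ∈ nhds x :=
    Filter.inter_mem (Filter.inter_mem hU ((hf x hxU).continuousAt
      (χ.open_source.mem_nhds (mem_chart_source _ _)))) (ψ.open_source.mem_nhds
        (mem_chart_source _ _))
  have hB : ψ.symm ⁻¹' (U ∩ f ⁻¹' χ.source ∩ ψ.source) ∩ ψ.target ∈ nhds (ψ x) := by
    refine Filter.inter_mem ((ψ.continuousAt_symm (ψ.map_source (mem_chart_source _ _))) ?_)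
      (ψ.open_target.mem_nhds (ψ.map_source (mem_chart_source _ _)))
    rw [ψ.left_inv (mem_chart_source _ _)]
    exact hV
  obtain ⟨r, hr, hball⟩ := Metric.mem_nhds_iff.1 hB
  have hder : ∀ u ∈ Metric.ball (ψ x) r, HasFDerivAt (χ ∘ f ∘ ψ.symm) (0 : E' →L[ℝ] E) u := by
    intro u hu
    obtain ⟨⟨⟨huU, hus⟩, huψ⟩, hut⟩ := hball hu
    have hc : MDifferentiableAt 𝓘(ℝ, E) 𝓘(ℝ, E) χ (f (ψ.symm u)) :=
      ((contMDiffOn_chart (I := 𝓘(ℝ, E)) (n := ∞)).contMDiffAt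
        (χ.open_source.mem_nhds hus)).mdifferentiableAt (by simp)
    have hs : MDifferentiableAt 𝓘(ℝ, E') 𝓘(ℝ, E') ψ.symm u :=
      ((contMDiffOn_chart_symm (I := 𝓘(ℝ, E')) (n := ∞)).contMDiffAt
        (ψ.open_target.mem_nhds hut)).mdifferentiableAt (by simp)
    have h1 := (hc.hasMFDerivAt.comp u ((hf _ huU).hasMFDerivAt.comp u
      hs.hasMFDerivAt)).hasFDerivAt
    refine h1.congr_fderiv ?_
    ext v
    exact (congrArg (mfderiv 𝓘(ℝ, E) 𝓘(ℝ, E) χ (f (ψ.symm u)))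
      (hd _ huU (mfderiv 𝓘(ℝ, E') 𝓘(ℝ, E') ψ.symm u v))).trans (map_zero _)
  have hconst : ∀ u ∈ Metric.ball (ψ x) r, (χ ∘ f ∘ ψ.symm) u = (χ ∘ f ∘ ψ.symm) (ψ x) := by
    intro u hu
    have := (convex_ball (ψ x) r).norm_image_sub_le_of_norm_hasFDerivWithin_le (C := 0)
      (fun w hw => (hder w hw).hasFDerivWithinAt) (by simp) (Metric.mem_ball_self hr) hu
    rw [zero_mul] at this
    exact sub_eq_zero.1 (norm_le_zero_iff.1 this)
  have hpre : ψ ⁻¹' Metric.ball (ψ x) r ∈ nhds x :=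
    (ψ.continuousAt (mem_chart_source _ _)) (Metric.ball_mem_nhds _ hr)
  filter_upwards [hpre, hV] with y hy hyV
  have h1 := hconst _ hy
  simp only [Function.comp, ψ.left_inv hyV.2, ψ.left_inv (mem_chart_source E' x)] at h1
  exact χ.injOn hyV.1.2 (mem_chart_source _ _) h1

end Constancy

/-! ### Gauge transformations between lifts and between sections -/

section Gauge

variable {EM EG EP : Type*}
  [NormedAddCommGroup EM] [NormedSpace ℝ EM]
  [NormedAddCommGroup EG] [NormedSpace ℝ EG]
  [NormedAddCommGroup EP] [NormedSpace ℝ EP]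
  {M G P : Type*}
  [TopologicalSpace M] [ChartedSpace EM M]
  [TopologicalSpace G] [ChartedSpace EG G] [Group G]
  [TopologicalSpace P] [ChartedSpace EP P] [MulAction Gᵐᵒᵖ P]
  {proj : P → M}

theorem IsPrincipalBundle.exists_op_smul_eq (hproj : IsPrincipalBundle EM EG EP (G := G) proj)
    {p q : P} (h : proj p = proj q) : ∃ g : G, p = MulOpposite.op g • q := by
  obtain ⟨e, hxe, -, -, he⟩ := hproj.exists_trivialization (proj q)
  have hq : q ∈ e.source := by rw [e.source_eq]; exact hxe
  have hp : p ∈ e.source := by rw [e.source_eq, mem_preimage, h]; exact hxe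
  refine ⟨(e q).2⁻¹ * (e p).2, e.injOn hp ?_ ?_⟩
  · rw [e.source_eq, mem_preimage, hproj.proj_act]; exact hxe
  · change e p = e (MulOpposite.op ((e q).2⁻¹ * (e p).2) • q)
    rw [he q hq, mul_inv_cancel_left, e.coe_fst hq, ← h, ← e.coe_fst hp]

theorem IsPrincipalBundle.op_smul_injective (hproj : IsPrincipalBundle EM EG EP (G := G) proj)
    {g h : G} {q : P} (hgh : MulOpposite.op g • q = MulOpposite.op h • q) : g = h := by
  obtain ⟨e, hxe, -, -, he⟩ := hproj.exists_trivialization (proj q)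
  have hq : q ∈ e.source := by rw [e.source_eq]; exact hxe
  have h1 := he q hq g
  rw [hgh, he q hq h] at h1
  exact (mul_left_cancel (Prod.ext_iff.1 h1).2).symm

variable [LieGroup 𝓘(ℝ, EG) ∞ G]

/-- No regularity of `g` is presupposed: in a trivialization `e` it is the quotient `(e b).2⁻¹ * (e
a).2` of differentiable maps. -/
theorem IsPrincipalBundle.mdifferentiableAt_gauge
    (hproj : IsPrincipalBundle EM EG EP (G := G) proj) {EN N : Type*} [NormedAddCommGroup EN]
    [NormedSpace ℝ EN] [TopologicalSpace N] [ChartedSpace EN N] {a b : N → P} {g : N → G} {n : N}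
    (ha : MDifferentiableAt 𝓘(ℝ, EN) 𝓘(ℝ, EP) a n) (hb : MDifferentiableAt 𝓘(ℝ, EN) 𝓘(ℝ, EP) b n)
    (hab : a =ᶠ[nhds n] fun m => MulOpposite.op (g m) • b m) :
    MDifferentiableAt 𝓘(ℝ, EN) 𝓘(ℝ, EG) g n := by
  obtain ⟨e, hxe, hes, -, he⟩ := hproj.exists_trivialization (proj (b n))
  have hbn : b n ∈ e.source := by rw [e.source_eq]; exact hxe
  have han : a n ∈ e.source := by
    rw [e.source_eq, mem_preimage, hab.self_of_nhds, hproj.proj_act]; exact hxe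
  have hed : ∀ {p}, p ∈ e.source →
      MDifferentiableAt 𝓘(ℝ, EP) 𝓘(ℝ, EG) (fun p => (e p).2) p := fun {p} hp =>
    (contMDiff_snd.contMDiffAt.comp p
      (hes.contMDiffAt (e.open_source.mem_nhds hp))).mdifferentiableAt (n := ∞) (by simp)
  have h1 : MDifferentiableAt 𝓘(ℝ, EN) 𝓘(ℝ, EG) (fun m => (e (b m)).2) n := (hed hbn).comp n hb
  have h2 : MDifferentiableAt 𝓘(ℝ, EN) 𝓘(ℝ, EG) (fun m => (e (a m)).2) n := (hed han).comp n ha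
  have hdiv : MDifferentiableAt (𝓘(ℝ, EG).prod 𝓘(ℝ, EG)) 𝓘(ℝ, EG)
      (fun q : G × G => q.1⁻¹ * q.2) ((e (b n)).2, (e (a n)).2) := by
    have : ContMDiff (𝓘(ℝ, EG).prod 𝓘(ℝ, EG)) 𝓘(ℝ, EG) ∞ (fun q : G × G => q.1⁻¹ * q.2) :=
      contMDiff_fst.inv.mul contMDiff_snd
    exact (this _).mdifferentiableAt (by simp)
  have h3 : MDifferentiableAt 𝓘(ℝ, EN) 𝓘(ℝ, EG) (fun m => (e (b m)).2⁻¹ * (e (a m)).2) n :=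
    hdiv.comp n (h1.prodMk h2)
  refine h3.congr_of_eventuallyEq ?_
  filter_upwards [hab, hb.continuousAt (e.open_source.mem_nhds hbn)] with m hm hbm
  rw [hm, he _ hbm]
  simp

theorem IsPrincipalBundle.continuousOn_gauge
    (hproj : IsPrincipalBundle EM EG EP (G := G) proj) {N : Type*} [TopologicalSpace N]
    {a b : N → P} {g : N → G} {s : Set N} (ha : ContinuousOn a s) (hb : ContinuousOn b s)
    (hab : ∀ m ∈ s, a m = MulOpposite.op (g m) • b m) : ContinuousOn g s := by
  have := topologicalGroup_of_lieGroup 𝓘(ℝ, EG) ∞ (G := G)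
  intro n hn
  obtain ⟨e, hxe, -, -, he⟩ := hproj.exists_trivialization (proj (b n))
  have hbn : b n ∈ e.source := by rw [e.source_eq]; exact hxe
  have han : a n ∈ e.source := by
    rw [e.source_eq, mem_preimage, hab n hn, hproj.proj_act]; exact hxe
  have h1 : ContinuousWithinAt (fun m => (e (b m)).2) s n :=
    (continuous_snd.continuousAt.comp (e.continuousAt hbn)).comp_continuousWithinAt (hb n hn)
  have h2 : ContinuousWithinAt (fun m => (e (a m)).2) s n :=
    (continuous_snd.continuousAt.comp (e.continuousAt han)).comp_continuousWithinAt (ha n hn)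
  refine (h1.inv.mul h2).congr_of_eventuallyEq_of_mem ?_ hn
  filter_upwards [self_mem_nhdsWithin, hb n hn (e.open_source.mem_nhds hbn)] with m hm hbm
  change g m = (e (b m)).2⁻¹ * (e (a m)).2
  rw [hab m hm, he _ hbm]
  simp

variable [IsManifold 𝓘(ℝ, EP) ∞ P]

/-- A curve is horizontal off a finite set of parameters. -/
def Connection.IsHorizontalOffFinite (θ : Connection EG EP G P) (c : ℝ → P) : Prop :=
  ∃ S : Set ℝ, S.Finite ∧ ∀ t ∈ Ioo (0 : ℝ) 1 \ S, MDifferentiableAt 𝓘(ℝ) 𝓘(ℝ, EP) c t ∧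
    θ.form (c t) (mfderiv 𝓘(ℝ) 𝓘(ℝ, EP) c t (1 : ℝ)) = 0

/-- Horizontal lifts are determined by their initial point. -/
theorem Connection.op_smul_eq_of_isHorizontalOffFinite [FiniteDimensional ℝ EG] [T1Space G]
    {θ : Connection EG EP G P} (hproj : IsPrincipalBundle EM EG EP (G := G) proj) {a b : ℝ → P}
    (ha : ContinuousOn a (Icc 0 1)) (hb : ContinuousOn b (Icc 0 1))
    (ha' : θ.IsHorizontalOffFinite a) (hb' : θ.IsHorizontalOffFinite b)
    (hab : ∀ t ∈ Icc (0 : ℝ) 1, proj (a t) = proj (b t)) {k : G}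
    (h0 : a 0 = MulOpposite.op k • b 0) :
    ∀ t ∈ Icc (0 : ℝ) 1, a t = MulOpposite.op k • b t := by
  have : CompleteSpace EG := FiniteDimensional.complete ℝ EG
  have hex : ∀ t ∈ Icc (0 : ℝ) 1, ∃ g : G, a t = MulOpposite.op g • b t := fun t ht =>
    hproj.exists_op_smul_eq (hab t ht)
  choose! g hg using hex
  have hgc : ContinuousOn g (Icc 0 1) := hproj.continuousOn_gauge ha hb hg
  obtain ⟨S, hS, hSa⟩ := ha'
  obtain ⟨T, hT, hTb⟩ := hb'
  have hconst := eq_of_mfderiv_eq_zero_off_finite (E := EG) (hS.union hT) hgc fun t ht => by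
    obtain ⟨ha1, ha2⟩ := hSa t ⟨ht.1, fun h => ht.2 (Or.inl h)⟩
    obtain ⟨hb1, hb2⟩ := hTb t ⟨ht.1, fun h => ht.2 (Or.inr h)⟩
    have hev : a =ᶠ[nhds t] fun m => MulOpposite.op (g m) • b m :=
      Filter.eventuallyEq_of_mem (Icc_mem_nhds ht.1.1 ht.1.2) hg
    have hgd := hproj.mdifferentiableAt_gauge ha1 hb1 hev
    exact ⟨hgd, θ.mfderiv_eq_zero_of_horizontal hproj.contMDiff_act _ hb1 hgd hev hb2 ha2⟩
  have hk : g 0 = k := hproj.op_smul_injective ((hg 0 (by simp)).symm.trans h0)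
  intro t ht
  rw [hg t ht, hconst t ht, hk]

/-- Two flat sections differ by a locally constant gauge transformation. -/
theorem Connection.IsFlatSection.eventually_eq [IsManifold 𝓘(ℝ, EM) ∞ M]
    {θ : Connection EG EP G P} (hproj : IsPrincipalBundle EM EG EP (G := G) proj)
    {s t : M → P} {U V : Set M} (hs : θ.IsFlatSection EM proj s U)
    (ht : θ.IsFlatSection EM proj t V) {g : M → G}
    (hg : ∀ x ∈ U ∩ V, s x = MulOpposite.op (g x) • t x) {x : M} (hx : x ∈ U ∩ V) :
    ∀ᶠ y in nhds x, g y = g x := by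
  have hUV : IsOpen (U ∩ V) := hs.isOpen.inter ht.isOpen
  have hsd : ∀ {s : M → P} {U : Set M}, θ.IsFlatSection EM proj s U → ∀ y ∈ U,
      MDifferentiableAt 𝓘(ℝ, EM) 𝓘(ℝ, EP) s y := fun hs y hy =>
    (hs.contMDiffOn.contMDiffAt (hs.isOpen.mem_nhds hy)).mdifferentiableAt (by simp)
  have hev : ∀ y ∈ U ∩ V, s =ᶠ[nhds y] fun m => MulOpposite.op (g m) • t m := fun y hy =>
    Filter.eventuallyEq_of_mem (hUV.mem_nhds hy) hg
  have hgd : ∀ y ∈ U ∩ V, MDifferentiableAt 𝓘(ℝ, EM) 𝓘(ℝ, EG) g y := fun y hy =>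
    hproj.mdifferentiableAt_gauge (hsd hs y hy.1) (hsd ht y hy.2) (hev y hy)
  have : IsManifold 𝓘(ℝ, EG) ∞ G := inferInstance
  exact eventually_eq_of_mfderiv_eq_zero (hUV.mem_nhds hx) hgd fun y hy v =>
    θ.mfderiv_eq_zero_of_horizontal hproj.contMDiff_act v (hsd ht y hy.2) (hgd y hy) (hev y hy)
      (ht.horizontal y hy.2 v) (hs.horizontal y hy.1 v)

end Gauge

/-! ### The covering by leaves and its monodromy -/

/-- A type with the discrete topology. -/
def DiscreteCopy (F : Type*) := F

instance (F : Type*) : TopologicalSpace (DiscreteCopy F) := ⊥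

instance (F : Type*) : DiscreteTopology (DiscreteCopy F) := ⟨rfl⟩

/-- The element of a type underlying an element of its discrete copy. -/
def DiscreteCopy.get {F : Type*} (v : DiscreteCopy F) : F := v

/-- Left translation on the discrete copy of a group. -/
def DiscreteCopy.mulLeft {F : Type*} [Group F] (g : F) : DiscreteCopy F → DiscreteCopy F :=
  fun v : F => g * v

section LeafLift

variable {EM EG EP : Type*}
  [NormedAddCommGroup EM] [NormedSpace ℝ EM]
  [NormedAddCommGroup EG] [NormedSpace ℝ EG]
  [NormedAddCommGroup EP] [NormedSpace ℝ EP]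
  {M G P : Type*}
  [TopologicalSpace M] [ChartedSpace EM M]
  [TopologicalSpace G] [ChartedSpace EG G] [Group G]
  [TopologicalSpace P] [ChartedSpace EP P] [MulAction Gᵐᵒᵖ P]
  {proj : P → M}

theorem IsPrincipalBundle.surjective (hproj : IsPrincipalBundle EM EG EP (G := G) proj) :
    Function.Surjective proj := fun x => by
  obtain ⟨e, hxe, -⟩ := hproj.exists_trivialization x
  exact ⟨e.toOpenPartialHomeomorph.symm (x, 1), e.proj_symm_apply' hxe⟩

variable (G) in
/-- The element of the group which takes `q` to `p` (if there is one). -/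
noncomputable def gauge (p q : P) : G :=
  open Classical in if h : ∃ g : G, p = MulOpposite.op g • q then h.choose else 1

theorem IsPrincipalBundle.gauge_spec (hproj : IsPrincipalBundle EM EG EP (G := G) proj) {p q : P}
    (h : proj p = proj q) : p = MulOpposite.op (gauge G p q) • q := by
  have hex := hproj.exists_op_smul_eq h
  rw [gauge, dif_pos hex]
  exact hex.choose_spec

variable [IsManifold 𝓘(ℝ, EP) ∞ P]

variable (EM) in
/-- A lift `c'` of `c` lies in a leaf of the horizontal foliation if it is locally the composition
of `c` with flat sections. -/
def Connection.IsLeafLift (θ : Connection EG EP G P) (proj : P → M) {X : Type*}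
    [TopologicalSpace X] (c : X → M) (c' : X → P) : Prop :=
  ∀ t, ∃ s U, θ.IsFlatSection EM proj s U ∧ c t ∈ U ∧ ∀ᶠ r in nhds t, c' r = s (c r)

variable [LieGroup 𝓘(ℝ, EG) ∞ G] [IsManifold 𝓘(ℝ, EM) ∞ M]

variable (EM) in
/-- The index set of all flat sections of a bundle. -/
def Connection.FlatSectionIndex (θ : Connection EG EP G P) (proj : P → M) :=
  {i : (M → P) × Set M // θ.IsFlatSection EM proj i.1 i.2}

theorem Connection.exists_flatSectionIndex [FiniteDimensional ℝ EM] [FiniteDimensional ℝ EG]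
    [FiniteDimensional ℝ EP] {θ : Connection EG EP G P} (hflat : θ.IsFlat)
    (hproj : IsPrincipalBundle EM EG EP (G := G) proj) (x : M) :
    ∃ i : θ.FlatSectionIndex EM proj, x ∈ i.1.2 := by
  obtain ⟨p, rfl⟩ := hproj.surjective x
  obtain ⟨s, U, hs, hp, -⟩ := θ.exists_isFlatSection hflat hproj p
  exact ⟨⟨(s, U), hs⟩, hp⟩

/-- The covering space of the base whose sheets are the flat sections. -/
noncomputable def Connection.leafBundle [FiniteDimensional ℝ EM] [FiniteDimensional ℝ EG]
    [FiniteDimensional ℝ EP] {θ : Connection EG EP G P} (hflat : θ.IsFlat)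
    (hproj : IsPrincipalBundle EM EG EP (G := G) proj) :
    FiberBundleCore (θ.FlatSectionIndex EM proj) M (DiscreteCopy G) where
  baseSet i := i.1.2
  isOpen_baseSet i := i.2.isOpen
  indexAt x := (Connection.exists_flatSectionIndex hflat hproj x).choose
  mem_baseSet_at x := (Connection.exists_flatSectionIndex hflat hproj x).choose_spec
  coordChange i j x := DiscreteCopy.mulLeft (gauge G (i.1.1 x) (j.1.1 x))
  coordChange_self i x hx v := by
    have h1 := hproj.gauge_spec (rfl : proj (i.1.1 x) = proj (i.1.1 x))
    have h2 : (1 : G) = gauge G (i.1.1 x) (i.1.1 x) :=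
      hproj.op_smul_injective (q := i.1.1 x) (by rw [← h1, MulOpposite.op_one, one_smul])
    rw [← h2]
    exact one_mul (M := G) v
  continuousOn_coordChange i j := by
    rintro ⟨x, v⟩ ⟨hx, -⟩
    -- The transition element is locally constant in `x`, and so is the point `v` of the discrete
    -- fibre; hence the coordinate change is locally constant.
    have hev := i.2.eventually_eq hproj j.2 (g := fun x => gauge G (i.1.1 x) (j.1.1 x))
      (fun y hy => hproj.gauge_spec (by rw [i.2.proj_eq y hy.1, j.2.proj_eq y hy.2])) hx
    have hv : ∀ᶠ w in nhds v, w = v := by rw [nhds_discrete]; exact Filter.eventually_pure.2 rfl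
    refine ContinuousAt.continuousWithinAt
      (ContinuousAt.congr (continuousAt_const
        (y := DiscreteCopy.mulLeft (gauge G (i.1.1 x) (j.1.1 x)) v)) ?_)
    rw [nhds_prod_eq]
    filter_upwards [hev.prod_mk hv] with q hq
    rw [hq.1, hq.2]
  coordChange_comp i j k x hx v := by
    have hij : proj (i.1.1 x) = proj (j.1.1 x) := by
      rw [i.2.proj_eq x hx.1.1, j.2.proj_eq x hx.1.2]
    have hjk : proj (j.1.1 x) = proj (k.1.1 x) := by
      rw [k.2.proj_eq x hx.2, j.2.proj_eq x hx.1.2]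
    have h : gauge G (j.1.1 x) (k.1.1 x) * gauge G (i.1.1 x) (j.1.1 x) =
        gauge G (i.1.1 x) (k.1.1 x) := by
      refine hproj.op_smul_injective (q := k.1.1 x) ?_
      rw [← op_smul_op_smul, ← hproj.gauge_spec hjk, ← hproj.gauge_spec hij,
        ← hproj.gauge_spec (hij.trans hjk)]
    rw [← h]
    exact (mul_assoc (G := G) _ _ _).symm

/-- The leaf covering maps to the total space of the bundle. -/
noncomputable def Connection.leafPoint [FiniteDimensional ℝ EM] [FiniteDimensional ℝ EG]
    [FiniteDimensional ℝ EP] {θ : Connection EG EP G P} (hflat : θ.IsFlat)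
    (hproj : IsPrincipalBundle EM EG EP (G := G) proj)
    (z : (Connection.leafBundle hflat hproj).TotalSpace) : P :=
  MulOpposite.op (DiscreteCopy.get (F := G) z.2) • ((Connection.leafBundle hflat hproj).indexAt z.1).1.1 z.1

/-- `leafPoint` is defined by the preferred section at each base point, which may jump. The
transition functions are the gauges between sections, so any sheet `i` computes it equally well. -/
theorem Connection.leafPoint_eq [FiniteDimensional ℝ EM] [FiniteDimensional ℝ EG]
    [FiniteDimensional ℝ EP] {θ : Connection EG EP G P} (hflat : θ.IsFlat)
    (hproj : IsPrincipalBundle EM EG EP (G := G) proj)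
    (z : (Connection.leafBundle hflat hproj).TotalSpace) (i : θ.FlatSectionIndex EM proj)
    (hi : z.1 ∈ i.1.2) :
    Connection.leafPoint hflat hproj z = MulOpposite.op
      ((Connection.leafBundle hflat hproj).localTriv i z).2.get • i.1.1 z.1 := by
  set j := (Connection.leafBundle hflat hproj).indexAt z.1 with hj
  have hjz : z.1 ∈ j.1.2 := (Connection.leafBundle hflat hproj).mem_baseSet_at z.1
  change MulOpposite.op (DiscreteCopy.get (F := G) z.2) • j.1.1 z.1 =
    MulOpposite.op (gauge G (j.1.1 z.1) (i.1.1 z.1) * DiscreteCopy.get (F := G) z.2) • i.1.1 z.1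
  rw [← op_smul_op_smul, ← hproj.gauge_spec]
  rw [i.2.proj_eq _ hi, j.2.proj_eq _ hjz]

/-- The fibre coordinate of a continuous map is continuous into a discrete space, hence locally
constant: locally the image follows one translate of one flat section. -/
theorem Connection.isLeafLift_leafPoint [FiniteDimensional ℝ EM] [FiniteDimensional ℝ EG]
    [FiniteDimensional ℝ EP] {θ : Connection EG EP G P} (hflat : θ.IsFlat)
    (hproj : IsPrincipalBundle EM EG EP (G := G) proj) {X : Type*} [TopologicalSpace X]
    {Γ : X → (Connection.leafBundle hflat hproj).TotalSpace} (hΓ : Continuous Γ) :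
    θ.IsLeafLift EM proj (fun t => (Γ t).1) (fun t => Connection.leafPoint hflat hproj (Γ t)) := by
  intro t
  obtain ⟨i, hi⟩ := Connection.exists_flatSectionIndex hflat hproj (Γ t).1
  set e := (Connection.leafBundle hflat hproj).localTriv i with he
  have hsrc : Γ t ∈ e.source := e.mem_source.2 hi
  have hcont : ContinuousAt (fun r => (e (Γ r)).2) t :=
    continuous_snd.continuousAt.comp ((e.continuousAt hsrc).comp hΓ.continuousAt)
  have hconst : ∀ᶠ r in nhds t, (e (Γ r)).2 = (e (Γ t)).2 := by
    have := hcont.tendsto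
    rw [nhds_discrete (DiscreteCopy G)] at this
    exact Filter.tendsto_pure.1 this
  refine ⟨_, _, i.2.op_smul hproj (e (Γ t)).2.get, hi, ?_⟩
  filter_upwards [hconst, hΓ.continuousAt (e.open_source.mem_nhds hsrc)] with r hr hrs
  rw [Connection.leafPoint_eq hflat hproj (Γ r) i (e.mem_source.1 hrs), hr]

/-- Homotopic paths have leaf lifts with the same initial point and the same end point. -/
theorem Connection.exists_isLeafLift [FiniteDimensional ℝ EM] [FiniteDimensional ℝ EG]
    [FiniteDimensional ℝ EP] {θ : Connection EG EP G P} (hflat : θ.IsFlat)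
    (hproj : IsPrincipalBundle EM EG EP (G := G) proj) {x y : M} (p : P) (hp : proj p = x)
    {c₁ c₂ : Path x y} (hc : c₁.Homotopic c₂) :
    ∃ q, ∃ d₁ d₂ : unitInterval → P, θ.IsLeafLift EM proj c₁ d₁ ∧
      θ.IsLeafLift EM proj c₂ d₂ ∧ d₁ 0 = p ∧ d₂ 0 = p ∧ d₁ 1 = q ∧ d₂ 1 = q := by
  set Z := Connection.leafBundle hflat hproj with hZ
  have cov : IsCoveringMap Z.proj := FiberBundle.isCoveringMap
  -- The point of the covering lying over `x` that `leafPoint` sends to `p`.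
  let z : Z.TotalSpace := ⟨x, (gauge G p ((Z.indexAt x).1.1 x) : G)⟩
  have hz : Connection.leafPoint hflat hproj z = p := by
    refine (hproj.gauge_spec ?_).symm
    rw [hp]
    exact ((Z.indexAt x).2.proj_eq x (Z.mem_baseSet_at x)).symm
  have h0 : ∀ c : Path x y, c.toContinuousMap 0 = Z.proj z := fun c => c.source
  -- The monodromy theorem for the leaf covering.
  have hend := cov.liftPath_apply_one_eq_of_homotopicRel hc z (h0 c₁) (h0 c₂)
  have hlift : ∀ c : Path x y, θ.IsLeafLift EM proj c
      (fun t => Connection.leafPoint hflat hproj (cov.liftPath _ z (h0 c) t)) := fun c => by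
    have h1 := Connection.isLeafLift_leafPoint hflat hproj
      (cov.liftPath _ z (h0 c)).continuous
    have h2 : (fun t => (cov.liftPath _ z (h0 c) t).1) = c := cov.liftPath_lifts _ z (h0 c)
    rwa [h2] at h1
  refine ⟨_, _, _, hlift c₁, hlift c₂, ?_, ?_, rfl, ?_⟩
  · exact (congrArg _ (cov.liftPath_zero _ z (h0 c₁))).trans hz
  · exact (congrArg _ (cov.liftPath_zero _ z (h0 c₂))).trans hz
  · exact congrArg _ hend.symm

end LeafLift

/-! ### Leaf lifts and horizontal lifts -/

section Lift

variable {EM EG EP : Type*}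
  [NormedAddCommGroup EM] [NormedSpace ℝ EM]
  [NormedAddCommGroup EG] [NormedSpace ℝ EG]
  [NormedAddCommGroup EP] [NormedSpace ℝ EP]
  {M G P : Type*}
  [TopologicalSpace M] [ChartedSpace EM M]
  [TopologicalSpace G] [ChartedSpace EG G] [Group G]
  [TopologicalSpace P] [ChartedSpace EP P] [MulAction Gᵐᵒᵖ P]
  [IsManifold 𝓘(ℝ, EP) ∞ P] {proj : P → M} {θ : Connection EG EP G P}

namespace Connection.IsLeafLift

variable {X : Type*} [TopologicalSpace X] {c : X → M} {c' : X → P}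

theorem proj_eq (h : θ.IsLeafLift EM proj c c') (t : X) : proj (c' t) = c t := by
  obtain ⟨s, U, hs, ht, he⟩ := h t
  rw [he.self_of_nhds, hs.proj_eq _ ht]

theorem continuous (h : θ.IsLeafLift EM proj c c') (hc : Continuous c) : Continuous c' := by
  refine continuous_iff_continuousAt.2 fun t => ?_
  obtain ⟨s, U, hs, ht, he⟩ := h t
  have h1 : ContinuousAt s (c t) := hs.contMDiffOn.continuousOn.continuousAt (hs.isOpen.mem_nhds ht)
  exact (h1.comp hc.continuousAt).congr (he.mono fun _ h => h.symm)

theorem comp (h : θ.IsLeafLift EM proj c c') {Y : Type*} [TopologicalSpace Y] {f : Y → X}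
    (hf : Continuous f) : θ.IsLeafLift EM proj (c ∘ f) (c' ∘ f) := fun t => by
  obtain ⟨s, U, hs, ht, he⟩ := h (f t)
  exact ⟨s, U, hs, ht, hf.continuousAt.eventually he⟩

theorem extend {x y : M} {p q : P} {c : Path x y} {c' : Path p q}
    (h : θ.IsLeafLift EM proj c c') : θ.IsLeafLift EM proj c.extend c'.extend :=
  h.comp continuous_projIcc

/-- A lift of a piecewise `C^1` path which lies in a leaf is horizontal. -/
theorem isHorizontal (hproj : IsPrincipalBundle EM EG EP (G := G) proj) {x y : M} {p q : P}
    {c : Path x y} {c' : Path p q}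
    (h : θ.IsLeafLift EM proj c c') (hc : IsPiecewiseC1 EM c) : θ.IsHorizontal c' := by
  obtain ⟨n, t, hmono, h0, h1, hcd⟩ := hc
  refine ⟨⟨n, t, hmono, h0, h1, fun i hi r hr => ?_⟩, fun r hr hd => ?_⟩
  · obtain ⟨s, U, hs, ht, he⟩ := h.extend r
    have hsr := hs.contMDiffOn.contMDiffAt (hs.isOpen.mem_nhds ht)
    exact (hsr.comp_contMDiffWithinAt r (hcd i hi r hr)).congr_of_eventuallyEq
      (mem_nhdsWithin_of_mem_nhds he) he.self_of_nhds
  · obtain ⟨s, U, hs, ht, he⟩ := h.extend r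
    have hsr := (hs.contMDiffOn.contMDiffAt (hs.isOpen.mem_nhds ht)).mdifferentiableAt (by simp)
    have hpd : MDifferentiableAt 𝓘(ℝ, EP) 𝓘(ℝ, EM) proj (c'.extend r) :=
      (hproj.contMDiff_proj _).mdifferentiableAt (by simp)
    -- The parameter may be a break point of the subdivision, so differentiability of `c` is
    -- recovered from that of the lift by projecting.
    have hcr : MDifferentiableAt 𝓘(ℝ) 𝓘(ℝ, EM) c.extend r := by
      have := hpd.comp r hd
      have heq : proj ∘ c'.extend = c.extend := funext h.extend.proj_eq
      rwa [heq] at this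
    have hm := (hsr.hasMFDerivAt.comp r hcr.hasMFDerivAt).congr_of_eventuallyEq he
    have h0 := hs.horizontal _ ht (mfderiv 𝓘(ℝ) 𝓘(ℝ, EM) c.extend r (1 : ℝ))
    have key : ∀ q (_ : q = s (c.extend r)) (v : EP), θ.form (s (c.extend r)) v = 0 →
        θ.form q v = 0 := by
      rintro q rfl v h; exact h
    exact key _ he.self_of_nhds _
      ((congrArg (θ.form (s (c.extend r))) (DFunLike.congr_fun hm.mfderiv (1 : ℝ))).trans h0)

end Connection.IsLeafLift

theorem exists_mem_Ioo_of_monotone {t : ℕ → ℝ} {n : ℕ} {r : ℝ} (h0 : t 0 < r) (hn : r < t n)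
    (hr : ∀ i ≤ n, r ≠ t i) : ∃ i < n, r ∈ Ioo (t i) (t (i + 1)) := by
  induction n with
  | zero => exact absurd h0 hn.not_gt
  | succ n ih =>
    rcases lt_or_gt_of_ne (hr n n.le_succ) with h | h
    · obtain ⟨i, hi, hir⟩ := ih h fun i hi => hr i (hi.trans n.le_succ)
      exact ⟨i, hi.trans n.lt_succ_self, hir⟩
    · exact ⟨n, n.lt_succ_self, h, hn⟩

/-- The exceptional set consists of the break points. The weaker notion suffices for uniqueness of
lifts and is easily seen to survive translation and concatenation. -/
theorem Connection.IsHorizontal.isHorizontalOffFinite {p q : P} {c : Path p q}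
    (h : θ.IsHorizontal c) : θ.IsHorizontalOffFinite c.extend := by
  obtain ⟨⟨n, t, -, h0, h1, hcd⟩, hh⟩ := h
  refine ⟨t '' Iic n, (finite_Iic n).image t, fun r ⟨hr, hrS⟩ => ?_⟩
  obtain ⟨i, hi, hir⟩ := exists_mem_Ioo_of_monotone (t := t) (n := n) (h0 ▸ hr.1) (h1 ▸ hr.2)
    fun i hi heq => hrS ⟨i, hi, heq.symm⟩
  have hd : MDifferentiableAt 𝓘(ℝ) 𝓘(ℝ, EP) c.extend r :=
    ((hcd i hi).contMDiffAt (Icc_mem_nhds hir.1 hir.2)).mdifferentiableAt (by simp)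
  exact ⟨hd, hh r hr hd⟩

theorem Connection.IsHorizontalOffFinite.op_smul
    (hproj : IsPrincipalBundle EM EG EP (G := G) proj) {c : ℝ → P}
    (h : θ.IsHorizontalOffFinite c) (g : G) :
    θ.IsHorizontalOffFinite fun t => MulOpposite.op g • c t := by
  obtain ⟨S, hS, hc⟩ := h
  refine ⟨S, hS, fun t ht => ?_⟩
  obtain ⟨hd, h0⟩ := hc t ht
  have h1 := (contMDiff_op_smul_left hproj.contMDiff_act g (c t)).mdifferentiableAt (by simp)
  have h3 := h1.hasMFDerivAt.comp t hd.hasMFDerivAt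
  have h4 := θ.form_act g (c t) (mfderiv 𝓘(ℝ) 𝓘(ℝ, EP) c t (1 : ℝ))
  rw [h0] at h4
  have h5 : Ad EG g⁻¹ (0 : GroupLieAlgebra 𝓘(ℝ, EG) G) = 0 := map_zero _
  exact ⟨h3.mdifferentiableAt,
    (congrArg (θ.form _) (DFunLike.congr_fun h3.mfderiv (1 : ℝ))).trans (h4.trans h5)⟩

/-- Horizontality is preserved by affine changes of the parameter. -/
theorem Connection.form_mfderiv_comp_affine {c c' : ℝ → P} {a b t : ℝ}
    (hc : MDifferentiableAt 𝓘(ℝ) 𝓘(ℝ, EP) c (a * t + b))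
    (h0 : θ.form (c (a * t + b)) (mfderiv 𝓘(ℝ) 𝓘(ℝ, EP) c (a * t + b) (1 : ℝ)) = 0)
    (he : c' =ᶠ[nhds t] fun r => c (a * r + b)) :
    MDifferentiableAt 𝓘(ℝ) 𝓘(ℝ, EP) c' t ∧
      θ.form (c' t) (mfderiv 𝓘(ℝ) 𝓘(ℝ, EP) c' t (1 : ℝ)) = 0 := by
  have h1 : HasMFDerivAt 𝓘(ℝ) 𝓘(ℝ) (fun r : ℝ => a * r + b) t
      (ContinuousLinearMap.toSpanSingleton ℝ a) := by
    have : HasDerivAt (fun r : ℝ => a * r + b) a t := by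
      simpa using ((hasDerivAt_id t).const_mul a).add_const b
    exact this.hasFDerivAt.hasMFDerivAt
  have h2 := (hc.hasMFDerivAt.comp t h1).congr_of_eventuallyEq he
  refine ⟨h2.mdifferentiableAt, ?_⟩
  have h3 : mfderiv 𝓘(ℝ) 𝓘(ℝ, EP) c' t (1 : ℝ) =
      a • mfderiv 𝓘(ℝ) 𝓘(ℝ, EP) c (a * t + b) (1 : ℝ) := by
    refine (DFunLike.congr_fun h2.mfderiv (1 : ℝ)).trans ?_
    refine Eq.trans ?_ (map_smul (mfderiv 𝓘(ℝ) 𝓘(ℝ, EP) c (a * t + b)) a (1 : ℝ))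
    change mfderiv 𝓘(ℝ) 𝓘(ℝ, EP) c (a * t + b) ((1 : ℝ) • a) = _
    congr 1
    exact (one_mul a).trans (mul_one a).symm
  have key : ∀ q (_ : q = c (a * t + b)) (v : EP), θ.form (c (a * t + b)) v = 0 →
      θ.form q v = 0 := by
    rintro q rfl v h; exact h
  refine key _ he.self_of_nhds _ ((congrArg (θ.form (c (a * t + b))) h3).trans ?_)
  exact (map_smul (θ.form (c (a * t + b))) a _).trans ((congrArg (a • ·) h0).trans (smul_zero a))

/-- The junction `1 / 2` joins the exceptional set, so nothing has to be checked there; elsewhere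
the path is locally an affine reparametrization of one of the two pieces. -/
theorem Connection.IsHorizontalOffFinite.trans {p q r : P} {c : Path p q} {d : Path q r}
    (hc : θ.IsHorizontalOffFinite c.extend) (hd : θ.IsHorizontalOffFinite d.extend) :
    θ.IsHorizontalOffFinite (c.trans d).extend := by
  obtain ⟨S, hS, hc⟩ := hc
  obtain ⟨T, hT, hd⟩ := hd
  refine ⟨{1 / 2} ∪ ((fun u : ℝ => u / 2) '' S ∪ (fun u : ℝ => (u + 1) / 2) '' T),
    (finite_singleton _).union ((hS.image _).union (hT.image _)), fun t ⟨ht, hts⟩ => ?_⟩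
  simp only [mem_union, mem_singleton_iff, mem_image, not_or, not_exists, not_and] at hts
  obtain ⟨hne, h1, h2⟩ := hts
  rcases lt_or_gt_of_ne hne with hlt | hgt
  · obtain ⟨hd', h0⟩ := hc (2 * t + 0) ⟨⟨by linarith [ht.1], by linarith⟩,
      fun hm => h1 _ hm (by ring)⟩
    refine Connection.form_mfderiv_comp_affine hd' h0 ?_
    filter_upwards [Iio_mem_nhds hlt] with u hu
    rw [Path.extend_trans_of_le_half _ _ (le_of_lt hu), add_zero]
  · obtain ⟨hd', h0⟩ := hd (2 * t + (-1)) ⟨⟨by linarith, by linarith [ht.2]⟩,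
      fun hm => h2 _ hm (by ring)⟩
    refine Connection.form_mfderiv_comp_affine hd' h0 ?_
    filter_upwards [Ioi_mem_nhds hgt] with u hu
    rw [Path.extend_trans_of_half_le _ _ (le_of_lt hu), sub_eq_add_neg]

end Lift

/-! ### Piecewise `C^1` representatives of homotopy classes -/

section Representatives

variable {E : Type*} [NormedAddCommGroup E] [NormedSpace ℝ E]
  {N : Type*} [TopologicalSpace N] [ChartedSpace E N]

theorem IsPiecewiseC1.of_contMDiffOn {x y : N} {c : Path x y}
    (h : ContMDiffOn 𝓘(ℝ) 𝓘(ℝ, E) 1 c.extend (Icc 0 1)) : IsPiecewiseC1 E c :=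
  ⟨1, fun i => i, Nat.mono_cast, by simp, by simp, fun i hi => by
    obtain rfl : i = 0 := by omega
    simpa using h⟩

theorem IsPiecewiseC1.refl (x : N) : IsPiecewiseC1 E (Path.refl x) := by
  refine .of_contMDiffOn ?_
  rw [Path.refl_extend]
  exact contMDiffOn_const

theorem IsPiecewiseC1.congr {x y x' y' : N} {c : Path x y} {c' : Path x' y'}
    (h : IsPiecewiseC1 E c) (hc : ∀ t, c' t = c t) : IsPiecewiseC1 E c' := by
  have : (c'.extend : ℝ → N) = c.extend := funext fun t => hc _
  unfold IsPiecewiseC1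
  rw [this]
  exact h

theorem IsPiecewiseC1.trans {x y z : N} {c : Path x y} {d : Path y z}
    (hc : IsPiecewiseC1 E c) (hd : IsPiecewiseC1 E d) : IsPiecewiseC1 E (c.trans d) := by
  obtain ⟨n, t, htm, ht0, ht1, hct⟩ := hc
  obtain ⟨m, u, hum, hu0, hu1, hdu⟩ := hd
  have ht1' : ∀ i ≤ n, t i ≤ 1 := fun i hi => ht1 ▸ htm hi
  have hu0' : ∀ i, 0 ≤ u i := fun i => hu0 ▸ hum (Nat.zero_le i)
  -- One formula for both halves, by truncated subtraction: for `i ≤ n` it is `t i / 2` because `u 0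
  -- = 0`, and for `i ≥ n` it is `(1 + u (i - n)) / 2` because `t n = 1`.
  refine ⟨n + m, fun i => (t (min i n) + u (i - n)) / 2, fun i j hij => ?_, ?_, ?_,
    fun i hi => ?_⟩
  · have h1 := htm (min_le_min_right n hij)
    have h2 := hum (Nat.sub_le_sub_right hij n)
    change (_ + _) / 2 ≤ (_ + _) / 2
    linarith
  · simp [ht0, hu0]
  · simp [ht1, hu1]
  · rcases lt_or_ge i n with h | h
    · have e1 : (t (min i n) + u (i - n)) / 2 = t i / 2 := by
        rw [min_eq_left h.le, Nat.sub_eq_zero_of_le h.le, hu0, add_zero]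
      have e2 : (t (min (i + 1) n) + u (i + 1 - n)) / 2 = t (i + 1) / 2 := by
        rw [min_eq_left h, Nat.sub_eq_zero_of_le h, hu0, add_zero]
      simp only [e1, e2]
      have hsm : ContMDiff 𝓘(ℝ) 𝓘(ℝ) 1 (fun r : ℝ => 2 * r) :=
        (contDiff_const.mul contDiff_id).contMDiff
      refine ((hct i h).comp hsm.contMDiffOn fun r hr => ?_).congr fun r hr => ?_
      · exact ⟨by linarith [hr.1], by linarith [hr.2]⟩
      · exact Path.extend_trans_of_le_half _ _ (by linarith [hr.2, ht1' (i + 1) h])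
    · have e1 : (t (min i n) + u (i - n)) / 2 = (1 + u (i - n)) / 2 := by
        rw [min_eq_right h, ht1]
      have e2 : (t (min (i + 1) n) + u (i + 1 - n)) / 2 = (1 + u (i - n + 1)) / 2 := by
        rw [min_eq_right (h.trans i.le_succ), ht1, Nat.sub_add_comm h]
      simp only [e1, e2]
      have hsm : ContMDiff 𝓘(ℝ) 𝓘(ℝ) 1 (fun r : ℝ => 2 * r - 1) :=
        ((contDiff_const.mul contDiff_id).sub contDiff_const).contMDiff
      refine ((hdu (i - n) (by omega)).comp hsm.contMDiffOn fun r hr => ?_).congr fun r hr => ?_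
      · exact ⟨by linarith [hr.1], by linarith [hr.2]⟩
      · exact Path.extend_trans_of_half_le _ _ (by linarith [hr.1, hu0' (i - n)])

variable [IsManifold 𝓘(ℝ, E) ∞ N]

/-- Every point has a neighbourhood in which any two points are joined by a `C^1` path to which all
other paths inside the neighbourhood are homotopic. -/
theorem exists_nhds_isPiecewiseC1_homotopic (E : Type*) [NormedAddCommGroup E] [NormedSpace ℝ E]
    {N : Type*} [TopologicalSpace N] [ChartedSpace E N] [IsManifold 𝓘(ℝ, E) ∞ N] (x : N) :
    ∃ W ∈ nhds x, ∀ y ∈ W, ∀ z ∈ W, ∃ d : Path y z, IsPiecewiseC1 E d ∧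
      ∀ c : Path y z, range c ⊆ W → c.Homotopic d := by
  set χ := chartAt E x with hχ
  obtain ⟨r, hr, hball⟩ := Metric.mem_nhds_iff.1 (χ.open_target.mem_nhds (mem_chart_target E x))
  set B := Metric.ball (χ x) r with hB
  have hBc : Convex ℝ B := convex_ball _ _
  -- The ball is simply connected, so any path in the neighbourhood is homotopic to the image of the
  -- straight segment with the same end points.
  have := Metric.contractibleSpace_ball (x := χ x) hr
  refine ⟨χ.source ∩ χ ⁻¹' B, Filter.inter_mem (χ.open_source.mem_nhds (mem_chart_source E x))
    (χ.continuousAt (mem_chart_source E x) (Metric.ball_mem_nhds _ hr)), fun y hy z hz => ?_⟩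
  let f : C(B, N) := ⟨fun u => χ.symm u, continuous_iff_continuousAt.2 fun u =>
    (χ.continuousAt_symm (hball u.2)).comp continuous_subtype_val.continuousAt⟩
  let ℓ : Path (⟨χ y, hy.2⟩ : B) ⟨χ z, hz.2⟩ :=
    { toFun := fun t => ⟨AffineMap.lineMap (χ y) (χ z) (t : ℝ), hBc.lineMap_mem hy.2 hz.2 t.2⟩
      continuous_toFun := by fun_prop
      source' := by simp
      target' := by simp }
  have hfy : y = f ⟨χ y, hy.2⟩ := (χ.left_inv hy.1).symm
  have hfz : z = f ⟨χ z, hz.2⟩ := (χ.left_inv hz.1).symm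
  refine ⟨(ℓ.map f.continuous).cast hfy hfz, .of_contMDiffOn ?_, fun c hc => ?_⟩
  · have hline : ContMDiff 𝓘(ℝ) 𝓘(ℝ, E) 1 (fun r : ℝ => AffineMap.lineMap (χ y) (χ z) r) := by
      refine ContDiff.contMDiff ?_
      simp only [AffineMap.lineMap_apply_module']
      fun_prop
    have hsymm : ContMDiffOn 𝓘(ℝ, E) 𝓘(ℝ, E) 1 χ.symm χ.target :=
      (contMDiffOn_chart_symm (I := 𝓘(ℝ, E)) (n := ∞)).of_le ENat.LEInfty.out
    refine (hsymm.comp hline.contMDiffOn fun r hr =>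
      hball (hBc.lineMap_mem hy.2 hz.2 hr)).congr fun r hr => ?_
    rw [Path.extend_apply _ hr]
    rfl
  · have hmem : ∀ t, c t ∈ χ.source ∩ χ ⁻¹' B := fun t => hc ⟨t, rfl⟩
    let c' : Path (⟨χ y, hy.2⟩ : B) ⟨χ z, hz.2⟩ :=
      { toFun := fun t => ⟨χ (c t), (hmem t).2⟩
        continuous_toFun := (χ.continuousOn.comp_continuous c.continuous
          fun t => (hmem t).1).subtype_mk _
        source' := by simp
        target' := by simp }
    have hcc : c = (c'.map f.continuous).cast hfy hfz := by
      ext t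
      exact (χ.left_inv (hmem t).1).symm
    rw [hcc]
    exact ((SimplyConnectedSpace.paths_homotopic c' ℓ).map f).pathCast hfy hfz

/-- Every path in a manifold is homotopic to a piecewise `C^1` path. -/
theorem exists_isPiecewiseC1_homotopic {x y : N} (c : Path x y) :
    ∃ d : Path x y, IsPiecewiseC1 E d ∧ c.Homotopic d := by
  -- `T t` concerns the initial piece of `c` up to `t`. It passes between nearby parameters in both
  -- directions, hence from 0 to 1 by connectedness.
  let T : unitInterval → Prop := fun t =>
    ∃ d : Path (c 0) (c t), IsPiecewiseC1 E d ∧ (c.subpath 0 t).Homotopic d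
  have hstep : ∀ a b : unitInterval, ∀ W : Set N, (∀ y ∈ W, ∀ z ∈ W, ∃ d : Path y z,
      IsPiecewiseC1 E d ∧ ∀ c : Path y z, range c ⊆ W → c.Homotopic d) →
      uIcc a b ⊆ c ⁻¹' W → T a → T b := by
    rintro a b W hW hab ⟨d, hd, hcd⟩
    obtain ⟨d', hd', h⟩ := hW (c a) (hab left_mem_uIcc) (c b) (hab right_mem_uIcc)
    refine ⟨d.trans d', hd.trans hd', ?_⟩
    have h1 := h (c.subpath a b) (by rw [Path.range_subpath]; exact image_subset_iff.2 hab)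
    exact Path.Homotopic.trans ⟨(Path.Homotopy.subpathTransSubpath c 0 a b).symm⟩ (hcd.hcomp h1)
  have h01 : T 0 → T 1 := by
    refine PreconnectedSpace.induction₂' (fun a b => T a → T b) (fun t => ?_)
      ⟨fun _ _ _ h h' => h' ∘ h⟩ 0 1
    obtain ⟨W, hWt, hW⟩ := exists_nhds_isPiecewiseC1_homotopic E (c t)
    have hpre : c ⁻¹' W ∈ nhds t := c.continuous.continuousAt hWt
    have hu : ∀ᶠ b in nhds t, uIcc t b ⊆ c ⁻¹' W :=
      ((tendsto_const_nhds (x := t)).uIcc Filter.tendsto_id).eventually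
        (Filter.eventually_smallSets_subset.2 hpre)
    filter_upwards [hu] with b hb
    exact ⟨hstep t b W hW hb, hstep b t W hW (by rwa [uIcc_comm])⟩
  obtain ⟨d, hd, hcd⟩ := h01 ⟨Path.refl _, .refl _, by rw [Path.subpath_self]⟩
  refine ⟨d.cast c.source.symm c.target.symm, hd.congr fun _ => rfl, ?_⟩
  rw [Path.subpath_zero_one] at hcd
  exact hcd.pathCast c.source.symm c.target.symm

end Representatives

/-! ### Holonomy as a homomorphism -/

section Holonomy

variable {EM EG EP : Type*}
  [NormedAddCommGroup EM] [NormedSpace ℝ EM] [FiniteDimensional ℝ EM]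
  [NormedAddCommGroup EG] [NormedSpace ℝ EG] [FiniteDimensional ℝ EG]
  [NormedAddCommGroup EP] [NormedSpace ℝ EP] [FiniteDimensional ℝ EP]
  {M G P : Type*}
  [TopologicalSpace M] [ChartedSpace EM M] [IsManifold 𝓘(ℝ, EM) ∞ M]
  [TopologicalSpace G] [ChartedSpace EG G] [Group G] [LieGroup 𝓘(ℝ, EG) ∞ G]
  [TopologicalSpace P] [ChartedSpace EP P] [IsManifold 𝓘(ℝ, EP) ∞ P] [MulAction Gᵐᵒᵖ P]
  {proj : P → M} {θ : Connection EG EP G P}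

/-- Homotopic piecewise `C^1` paths have horizontal lifts with common end points. -/
theorem Connection.exists_isHorizontal (hflat : θ.IsFlat)
    (hproj : IsPrincipalBundle EM EG EP (G := G) proj) {x y : M} (p : P) (hp : proj p = x)
    {c₁ c₂ : Path x y} (h₁ : IsPiecewiseC1 EM c₁) (h₂ : IsPiecewiseC1 EM c₂)
    (hc : c₁.Homotopic c₂) :
    ∃ q, ∃ d₁ d₂ : Path p q, θ.IsHorizontal d₁ ∧ θ.IsHorizontal d₂ ∧
      (∀ t, proj (d₁ t) = c₁ t) ∧ ∀ t, proj (d₂ t) = c₂ t := by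
  obtain ⟨q, d₁, d₂, hd₁, hd₂, h1, h2, h3, h4⟩ := Connection.exists_isLeafLift hflat hproj p hp hc
  exact ⟨q, ⟨⟨d₁, hd₁.continuous c₁.continuous⟩, h1, h3⟩,
    ⟨⟨d₂, hd₂.continuous c₂.continuous⟩, h2, h4⟩,
    Connection.IsLeafLift.isHorizontal hproj hd₁ h₁,
    Connection.IsLeafLift.isHorizontal hproj hd₂ h₂, hd₁.proj_eq, hd₂.proj_eq⟩

variable [T1Space G]

omit [FiniteDimensional ℝ EM] [FiniteDimensional ℝ EP] [IsManifold 𝓘(ℝ, EM) ∞ M] in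
/-- Lifts of a path which are horizontal off finite sets and start in the same point have the same
end point. -/
theorem Connection.IsHorizontalOffFinite.target_eq
    (hproj : IsPrincipalBundle EM EG EP (G := G) proj) {p q r : P} {a : Path p q} {b : Path p r}
    (ha : θ.IsHorizontalOffFinite a.extend) (hb : θ.IsHorizontalOffFinite b.extend)
    (hab : ∀ t, proj (a t) = proj (b t)) : q = r := by
  have := Connection.op_smul_eq_of_isHorizontalOffFinite hproj a.continuous_extend.continuousOn
    b.continuous_extend.continuousOn ha hb (fun t _ => hab _) (k := (1 : G))
    (by rw [a.extend_zero, b.extend_zero, MulOpposite.op_one, one_smul]) 1 (by simp)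
  rwa [a.extend_one, b.extend_one, MulOpposite.op_one, one_smul] at this

variable {x₀ : M} {p₀ : P}

omit [T1Space G] in
/-- Homotopic loops have a common holonomy. -/
theorem Connection.exists_isHolonomy_of_homotopic (hflat : θ.IsFlat)
    (hproj : IsPrincipalBundle EM EG EP (G := G) proj) (hp₀ : proj p₀ = x₀)
    {c₁ c₂ : Path x₀ x₀} (h₁ : IsPiecewiseC1 EM c₁) (h₂ : IsPiecewiseC1 EM c₂)
    (hc : c₁.Homotopic c₂) :
    ∃ g : G, θ.IsHolonomy proj p₀ c₁ g ∧ θ.IsHolonomy proj p₀ c₂ g := by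
  obtain ⟨q, d₁, d₂, hd₁, hd₂, hp₁, hp₂⟩ :=
    Connection.exists_isHorizontal hflat hproj p₀ hp₀ h₁ h₂ hc
  have hq : proj q = proj p₀ := by rw [← d₁.target, hp₁, c₁.target, hp₀]
  obtain ⟨g, rfl⟩ := hproj.exists_op_smul_eq hq
  exact ⟨g, ⟨d₁, hd₁, hp₁⟩, ⟨d₂, hd₂, hp₂⟩⟩

omit [FiniteDimensional ℝ EM] [FiniteDimensional ℝ EP] [IsManifold 𝓘(ℝ, EM) ∞ M] in
theorem Connection.IsHolonomy.unique (hproj : IsPrincipalBundle EM EG EP (G := G) proj)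
    {c : Path x₀ x₀} {g h : G} (hg : θ.IsHolonomy proj p₀ c g) (hh : θ.IsHolonomy proj p₀ c h) :
    g = h := by
  obtain ⟨a, ha, hac⟩ := hg
  obtain ⟨b, hb, hbc⟩ := hh
  exact hproj.op_smul_injective (ha.isHorizontalOffFinite.target_eq hproj
    hb.isHorizontalOffFinite fun t => (hac t).trans (hbc t).symm)

/-- The holonomy of the loop which runs first through `c₂` and then through `c₁`. -/
theorem Connection.IsHolonomy.trans (hflat : θ.IsFlat)
    (hproj : IsPrincipalBundle EM EG EP (G := G) proj) (hp₀ : proj p₀ = x₀)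
    {c₁ c₂ : Path x₀ x₀} (h₁ : IsPiecewiseC1 EM c₁) (h₂ : IsPiecewiseC1 EM c₂) {g₁ g₂ : G}
    (hg₁ : θ.IsHolonomy proj p₀ c₁ g₁) (hg₂ : θ.IsHolonomy proj p₀ c₂ g₂) :
    θ.IsHolonomy proj p₀ (c₂.trans c₁) (g₁ * g₂) := by
  -- Flatness supplies some genuine horizontal lift of the concatenation, with holonomy `h`. The
  -- explicit lift built next is only known to be horizontal off a finite set, which is enough to
  -- identify `h`.
  obtain ⟨h, hh, -⟩ := Connection.exists_isHolonomy_of_homotopic hflat hproj hp₀ (h₂.trans h₁)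
    (h₂.trans h₁) (Path.Homotopic.refl _)
  obtain ⟨d₁, hd₁, hp₁⟩ := hg₁
  obtain ⟨d₂, hd₂, hp₂⟩ := hg₂
  have hact : Continuous fun p : P => MulOpposite.op g₂ • p :=
    (contMDiff_op_smul_left hproj.contMDiff_act g₂).continuous
  -- The lift of `c₁` is translated by `g₂` so that it starts where `d₂` ends; it then ends at `(p₀
  -- · g₁) · g₂`.
  have hd₁' : θ.IsHorizontalOffFinite (d₁.map hact).extend :=
    hd₁.isHorizontalOffFinite.op_smul hproj g₂
  have hd := hd₂.isHorizontalOffFinite.trans hd₁'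
  have key : h = g₁ * g₂ := by
    obtain ⟨d, hd', hp⟩ := hh
    refine hproj.op_smul_injective (q := p₀) ?_
    rw [← op_smul_op_smul]
    refine hd'.isHorizontalOffFinite.target_eq hproj hd fun t => (hp t).trans ?_
    rw [Path.trans_apply, Path.trans_apply]
    split_ifs
    · exact (hp₂ _).symm
    · rw [Path.map_coe]
      exact ((hproj.proj_act _ _).trans (hp₁ _)).symm
  rwa [← key]

theorem exists_isPiecewiseC1_mk_eq {E : Type*} [NormedAddCommGroup E] [NormedSpace ℝ E]
    {N : Type*} [TopologicalSpace N] [ChartedSpace E N] [IsManifold 𝓘(ℝ, E) ∞ N] {x : N}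
    (a : FundamentalGroup N x) : ∃ c : Path x x, IsPiecewiseC1 E c ∧
      FundamentalGroup.fromPath (Path.Homotopic.Quotient.mk c) = a := by
  obtain ⟨c, rfl⟩ := Path.Homotopic.Quotient.mk_surjective (a : Path.Homotopic.Quotient x x)
  obtain ⟨d, hd, hcd⟩ := exists_isPiecewiseC1_homotopic (E := E) c
  exact ⟨d, hd, Path.Homotopic.Quotient.eq.2 hcd.symm⟩

/-- The holonomy of a flat connection as a homomorphism on the fundamental group. -/
theorem Connection.exists_holonomyHom (hflat : θ.IsFlat)
    (hproj : IsPrincipalBundle EM EG EP (G := G) proj) (hp₀ : proj p₀ = x₀) :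
    ∃ Φ : FundamentalGroup M x₀ →* G, ∀ c : Path x₀ x₀, IsPiecewiseC1 EM c →
      θ.IsHolonomy proj p₀ c (Φ (FundamentalGroup.fromPath (Path.Homotopic.Quotient.mk c))) := by
  have hex : ∀ a : FundamentalGroup M x₀, ∃ g : G, ∀ c : Path x₀ x₀, IsPiecewiseC1 EM c →
      FundamentalGroup.fromPath (Path.Homotopic.Quotient.mk c) = a →
      θ.IsHolonomy proj p₀ c g := fun a => by
    obtain ⟨c, hc, rfl⟩ := exists_isPiecewiseC1_mk_eq (E := EM) a
    obtain ⟨g, hg, -⟩ := Connection.exists_isHolonomy_of_homotopic hflat hproj hp₀ hc hc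
      (Path.Homotopic.refl c)
    refine ⟨g, fun d hd hdc => ?_⟩
    obtain ⟨h, hh₁, hh₂⟩ := Connection.exists_isHolonomy_of_homotopic hflat hproj hp₀ hc hd
      (Path.Homotopic.Quotient.eq.1 hdc.symm)
    rwa [hg.unique hproj hh₁]
  choose Φ hΦ using hex
  refine ⟨MonoidHom.mk' Φ fun a b => ?_, fun c hc => hΦ _ c hc rfl⟩
  obtain ⟨c₁, hc₁, rfl⟩ := exists_isPiecewiseC1_mk_eq (E := EM) a
  obtain ⟨c₂, hc₂, rfl⟩ := exists_isPiecewiseC1_mk_eq (E := EM) b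
  have h := (hΦ _ c₁ hc₁ rfl).trans hflat hproj hp₀ hc₁ hc₂ (hΦ _ c₂ hc₂ rfl)
  -- The final `rfl` is the convention for products: `[c₁] * [c₂]` is by definition the class of
  -- `c₂.trans c₁`.
  exact (hΦ _ (c₂.trans c₁) (hc₂.trans hc₁) rfl).unique hproj h

end Holonomy

end FlatBundle

theorem corollary1
    {EM EG EP : Type*}
    [NormedAddCommGroup EM] [NormedSpace ℝ EM] [FiniteDimensional ℝ EM]
    [NormedAddCommGroup EG] [NormedSpace ℝ EG] [FiniteDimensional ℝ EG]
    [NormedAddCommGroup EP] [NormedSpace ℝ EP] [FiniteDimensional ℝ EP]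
    {M G P : Type*}
    [TopologicalSpace M] [ChartedSpace EM M] [IsManifold 𝓘(ℝ, EM) ∞ M] [T2Space M]
    [TopologicalSpace G] [ChartedSpace EG G] [Group G] [LieGroup 𝓘(ℝ, EG) ∞ G] [T2Space G]
    [TopologicalSpace P] [ChartedSpace EP P] [IsManifold 𝓘(ℝ, EP) ∞ P] [T2Space P]
    [MulAction Gᵐᵒᵖ P]
    (proj : P → M) (hproj : FlatBundle.IsPrincipalBundle EM EG EP (G := G) proj)
    (θ : FlatBundle.Connection EG EP G P) (hflat : θ.IsFlat)
    (x₀ : M) (p₀ : P) (hp₀ : proj p₀ = x₀) :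
    -- every homotopy class of loops contains a piecewise `C^1` loop
    (∀ a : FundamentalGroup M x₀, ∃ c : Path x₀ x₀, FlatBundle.IsPiecewiseC1 EM c ∧
      FundamentalGroup.fromPath (Path.Homotopic.Quotient.mk c) = a) ∧
    -- every piecewise `C^1` loop has exactly one holonomy
    (∀ c : Path x₀ x₀, FlatBundle.IsPiecewiseC1 EM c → ∃! g : G, θ.IsHolonomy proj p₀ c g) ∧
    -- homotopic loops have the same holonomy
    (∀ c₁ c₂ : Path x₀ x₀, FlatBundle.IsPiecewiseC1 EM c₁ → FlatBundle.IsPiecewiseC1 EM c₂ →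
      c₁.Homotopic c₂ → ∀ g : G, θ.IsHolonomy proj p₀ c₁ g ↔ θ.IsHolonomy proj p₀ c₂ g) ∧
    -- the holonomies form a subgroup, and `[c] ↦ holonomy of c` is a homomorphism onto it
    ∃ Hol : Subgroup G, (Hol : Set G) = θ.holonomySet EM proj p₀ x₀ ∧
      ∃ φ : FundamentalGroup M x₀ →* Hol, Function.Surjective φ ∧
        ∀ c : Path x₀ x₀, FlatBundle.IsPiecewiseC1 EM c →
          θ.IsHolonomy proj p₀ c
            (φ (FundamentalGroup.fromPath (Path.Homotopic.Quotient.mk c)) : G) := by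
  refine ⟨FlatBundle.exists_isPiecewiseC1_mk_eq, fun c hc => ?_, fun c₁ c₂ h₁ h₂ hc g => ?_, ?_⟩
  · obtain ⟨g, hg, -⟩ := FlatBundle.Connection.exists_isHolonomy_of_homotopic hflat hproj hp₀ hc hc
      (Path.Homotopic.refl c)
    exact ⟨g, hg, fun h hh => hh.unique hproj hg⟩
  · obtain ⟨h, hh₁, hh₂⟩ :=
      FlatBundle.Connection.exists_isHolonomy_of_homotopic hflat hproj hp₀ h₁ h₂ hc
    exact ⟨fun hg => hg.unique hproj hh₁ ▸ hh₂, fun hg => hg.unique hproj hh₂ ▸ hh₁⟩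
  · obtain ⟨Φ, hΦ⟩ := FlatBundle.Connection.exists_holonomyHom hflat hproj hp₀
    -- Taking the range as the holonomy group makes surjectivity automatic. That it equals the set
    -- of holonomies uses representatives in one direction and uniqueness in the other.
    refine ⟨Φ.range, Set.ext fun g => ⟨?_, ?_⟩, Φ.rangeRestrict, Φ.rangeRestrict_surjective, hΦ⟩
    · rintro ⟨a, rfl⟩
      obtain ⟨c, hc, rfl⟩ := FlatBundle.exists_isPiecewiseC1_mk_eq (E := EM) a
      exact ⟨c, hc, hΦ c hc⟩
    · rintro ⟨c, hc, hg⟩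
      exact ⟨_, (hΦ c hc).unique hproj hg⟩
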